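/- Let $R$ be a Dedekind domain, not a field, with field of fractions $Q$, let $A$ be a finite-dimensional semisimple $Q$-algebra, and let $\Lambda$ be an $R$-order in $A$, i.e. a subring of $A$ whose centre contains $R$, which is finitely generated as an $R$-module and satisfies $Q\Lambda=A$. For a maximal ideal $P$ of $R$ let $R_P$ be the localization and $\widehat R_P$ the $P$-adic completion of $R$, and put $\Lambda_P=R_P\otimes_R\Lambda$ and $\widehat\Lambda_P=\widehat R_P\otimes_R\Lambda$ (the $P$-adic completion of $\Lambda$). For a ring $S$ let $\mathrm{Zg}_S$ be the set of isomorphism classes of indecomposable pure-injective right $S$-modules. Let $\mathrm{Zg}_\Lambda^{tf}$, $\mathrm{Zg}_{\Lambda_P}^{tf}$, $\mathrm{Zg}_{\widehat\Lambda_P}^{tf}$ be the subsets of classes of modules that are torsionfree over $R$, $R_P$, $\widehat R_P$ respectively. A $\Lambda_P$- or $\widehat\Lambda_P$-module $N$ is called $R_P$-reduced if $\bigcap_{i\ge 0}NP^i=0$; let $\mathrm{Zg}_{\Lambda_P}^{tf+red}$ and $\mathrm{Zg}_{\widehat\Lambda_P}^{tf+red}$ be the sets of $R_P$-reduced points of $\mathrm{Zg}_{\Lambda_P}^{tf}$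 and $\mathrm{Zg}_{\widehat\Lambda_P}^{tf}$. Modules over $A$, $\Lambda_P$ and $\widehat\Lambda_P$ are regarded as modules over $\Lambda$, and modules over $\widehat\Lambda_P$ as modules over $\Lambda_P$, by restriction of scalars along the canonical ring homomorphisms. Then: 1. For every $N\in\mathrm{Zg}_\Lambda^{tf}$, either $N$ is (the restriction of) a simple $A$-module, or there is a maximal ideal $P$ of $R$ such that $N$ is (the restriction of) an $R_P$-reduced module in $\mathrm{Zg}_{\Lambda_P}^{tf}$. 2. Conversely, for every maximal ideal $P$, the restriction to $\Lambda$ of an $R_P$-reduced module in $\mathrm{Zg}_{\Lambda_P}^{tf}$ lies in $\mathrm{Zg}_\Lambda^{tf}$, and it determines the $\Lambda_P$-module up to isomorphism. 3. For every maximal ideal $P$, a $\widehat\Lambda_P$-module belongs to $\mathrm{Zg}_{\widehat\Lambda_P}^{tf+red}$ if and only if its restriction to $\Lambda_P$ belongs to $\mathrm{Zg}_{\Lambda_P}^{tf+red}$, and restriction of scalars is a bijection from $\mathrm{Zg}_{\widehat\Lambda_P}^{tf+red}$ onto $\mathrm{Zg}_{\Lambda_P}^{tf+red}$. 4. Restriction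 to $\Lambda$ is injective on $\mathrm{Zg}_A$ and on each $\mathrm{Zg}_{\widehat\Lambda_P}^{tf+red}$, and, identifying these sets with their images, $\mathrm{Zg}_\Lambda^{tf}$ is, as a set, the disjoint union of $\mathrm{Zg}_A$ and the sets $\mathrm{Zg}_{\widehat\Lambda_P}^{tf+red}$, where $P$ ranges over the maximal ideals of $R$. -/

import Mathlib

open scoped TensorProduct
open CategoryTheory IsDedekindDomain

universe u v w

namespace OrderZiegler

noncomputable section

/-! ### Pure-injective and indecomposable modules -/

/-- A linear map is a pure embedding if every finite system of linear equations with constants from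
the source that is solvable in the target is already solvable in the source. (The equation
`0 = f b` is such a system in no unknowns, so a pure embedding is injective.) -/
def IsPureEmbedding {S : Type u} [Ring S] {X Y : Type v} [AddCommGroup X] [Module S X]
    [AddCommGroup Y] [Module S Y] (f : X →ₗ[S] Y) : Prop :=
  ∀ (m n : ℕ) (a : Fin m → Fin n → S) (b : Fin m → X),
    (∃ y : Fin n → Y, ∀ i, ∑ j, a i j • y j = f (b i)) →
      ∃ x : Fin n → X, ∀ i, ∑ j, a i j • x j = b i

/-- `N` is pure-injective if homomorphisms into `N` extend along pure embeddings. -/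
def IsPureInjective (S : Type u) [Ring S] (N : Type v) [AddCommGroup N] [Module S N] : Prop :=
  ∀ (X Y : Type (max u v)) [AddCommGroup X] [Module S X] [AddCommGroup Y] [Module S Y]
    (f : X →ₗ[S] Y), IsPureEmbedding f →
      ∀ g : X →ₗ[S] N, ∃ h : Y →ₗ[S] N, h ∘ₗ f = g

/-- `N` is indecomposable: nonzero, and not the direct sum of two nonzero submodules. -/
def IsIndecomposable (S : Type u) [Ring S] (N : Type v) [AddCommGroup N] [Module S N] : Prop :=
  Nontrivial N ∧ ∀ X Y : Submodule S N, IsCompl X Y → X = ⊥ ∨ Y = ⊥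

/-- A module `N` over a `T`-algebra `S` is `T`-torsionfree. -/
def IsTorsionfreeOver (T : Type u) [CommRing T] (S : Type u) [Ring S] [Algebra T S]
    (N : Type v) [AddCommGroup N] [Module S N] : Prop :=
  ∀ r : T, r ≠ 0 → ∀ x : N, algebraMap T S r • x = 0 → x = 0

/-- For a module `N` over an `R`-algebra `S` and an ideal `I` of `R`, the submodule `N I`. -/
def idealMul {R : Type u} [CommRing R] (S : Type u) [Ring S] [Algebra R S] (I : Ideal R)
    (N : Type v) [AddCommGroup N] [Module S N] : Submodule S N :=
  Submodule.span S {x | ∃ r ∈ I, ∃ y : N, x = algebraMap R S r • y}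

/-- `N` is reduced at `P`: the intersection of all `N Pⁱ` is zero. -/
def IsReducedAt {R : Type u} [CommRing R] (S : Type u) [Ring S] [Algebra R S] (P : Ideal R)
    (N : Type v) [AddCommGroup N] [Module S N] : Prop :=
  ⨅ i : ℕ, idealMul S (P ^ i) N = ⊥

/-! ### Right modules, their isomorphism classes, and points of the Ziegler spectrum -/

/-- The category of right `S`-modules. -/
abbrev RightMod (S : Type u) [Ring S] := ModuleCat.{w} Sᵐᵒᵖ

/-- The isomorphism classes of right `S`-modules. -/
abbrev RightModClass (S : Type u) [Ring S] := Quotient (isIsomorphicSetoid (RightMod.{u, w} S))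

/-- The isomorphism class of a right `S`-module. -/
def cls {S : Type u} [Ring S] (N : RightMod.{u, w} S) : RightModClass.{u, w} S :=
  Quotient.mk (isIsomorphicSetoid (RightMod.{u, w} S)) N

/-- Restriction of scalars of right modules along `f : S → S'`, on isomorphism classes. -/
def res {S S' : Type u} [Ring S] [Ring S'] (f : S →+* S') :
    RightModClass.{u, w} S' → RightModClass.{u, w} S :=
  Quotient.map (ModuleCat.restrictScalars (RingHom.op f)).obj
    fun _ _ h => h.map fun e => (ModuleCat.restrictScalars (RingHom.op f)).mapIso e

/-- The points of the (right) Ziegler spectrum of `S`: the isomorphism classes of indecomposable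
pure-injective right `S`-modules. -/
def Zg (S : Type u) [Ring S] : Set (RightModClass.{u, w} S) :=
  {c | ∃ N : RightMod.{u, w} S,
    cls N = c ∧ IsIndecomposable Sᵐᵒᵖ N ∧ IsPureInjective Sᵐᵒᵖ N}

/-- The points of the Ziegler spectrum of the `T`-algebra `S` that are `T`-torsionfree. -/
def ZgTf (T : Type u) [CommRing T] (S : Type u) [Ring S] [Algebra T S] :
    Set (RightModClass.{u, w} S) :=
  {c | ∃ N : RightMod.{u, w} S,
    cls N = c ∧ IsIndecomposable Sᵐᵒᵖ N ∧ IsPureInjective Sᵐᵒᵖ N ∧ IsTorsionfreeOver T Sᵐᵒᵖ N}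

/-- The isomorphism classes of right modules over the `R`-algebra `S` that are reduced at `P`. -/
def Red {R : Type u} [CommRing R] (S : Type u) [Ring S] [Algebra R S] (P : Ideal R) :
    Set (RightModClass.{u, w} S) :=
  {c | ∃ N : RightMod.{u, w} S, cls N = c ∧ IsReducedAt Sᵐᵒᵖ P N}

/-- The isomorphism classes of simple right `S`-modules. -/
def SimpleClasses (S : Type u) [Ring S] : Set (RightModClass.{u, w} S) :=
  {c | ∃ N : RightMod.{u, w} S, cls N = c ∧ IsSimpleModule Sᵐᵒᵖ N}

/-! ### Orders, their localizations and completions -/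

/-- The `R`-subalgebra `Λ` of the `Q`-algebra `A` is an `R`-order in `A`: it is finitely generated
as an `R`-module and `Q · Λ = A`. -/
structure IsOrder {R : Type u} (Q : Type u) {A : Type u} [CommRing R] [Field Q] [Ring A]
    [Algebra R A] [Algebra Q A] (Λ : Subalgebra R A) : Prop where
  finite : Module.Finite R Λ
  span_eq_top : Submodule.span Q (Λ : Set A) = ⊤

section Local

variable {R : Type u} (Q : Type u) {A : Type u} [CommRing R] [IsDedekindDomain R] [Field Q]
  [Algebra R Q] [IsFractionRing R Q] [Ring A] [Algebra R A]

/-- `R_P`, the localization of `R` at the maximal ideal `P`. -/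
abbrev LocR (P : HeightOneSpectrum R) : Type u := Localization.AtPrime P.asIdeal

/-- `R̂_P`, the `P`-adic completion of `R`: the ring of integers of the `P`-adic completion of
the field of fractions `Q`. -/
abbrev ComplR (P : HeightOneSpectrum R) : Type u := P.adicCompletionIntegers Q

/-- `Λ_P = R_P ⊗ Λ`, the central localization of `Λ` at `P`. -/
abbrev LocOrder (Λ : Subalgebra R A) (P : HeightOneSpectrum R) : Type u := LocR P ⊗[R] Λ

/-- `Λ̂_P = R̂_P ⊗ Λ`, the `P`-adic completion of `Λ` (which is finitely generated over `R`). -/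
abbrev ComplOrder (Λ : Subalgebra R A) (P : HeightOneSpectrum R) : Type u := ComplR Q P ⊗[R] Λ

theorem isUnit_complR (P : HeightOneSpectrum R) (s : P.asIdeal.primeCompl) :
    IsUnit (Algebra.ofId R (ComplR Q P) s) := by
  rw [HeightOneSpectrum.adicCompletionIntegers.isUnit_iff_valued_eq_one]
  change Valued.v ((algebraMap R Q (s : R) : Q) : P.adicCompletion Q) = 1
  rw [HeightOneSpectrum.valuedAdicCompletion_eq_valuation']
  exact P.valuation_eq_one_iff_notMem.2 s.2

/-- The canonical homomorphism `R_P → R̂_P`. -/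
def locRToComplR (P : HeightOneSpectrum R) : LocR P →ₐ[R] ComplR Q P :=
  IsLocalization.liftAlgHom (M := P.asIdeal.primeCompl) (f := Algebra.ofId R (ComplR Q P))
    (isUnit_complR Q P)

/-- The canonical homomorphism `Λ → Λ_P`. -/
def toLocOrder (Λ : Subalgebra R A) (P : HeightOneSpectrum R) : Λ →+* LocOrder Λ P :=
  (Algebra.TensorProduct.includeRight : Λ →ₐ[R] LocR P ⊗[R] Λ).toRingHom

/-- The canonical homomorphism `Λ_P → Λ̂_P`. -/
def locToComplOrder (Λ : Subalgebra R A) (P : HeightOneSpectrum R) :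
    LocOrder Λ P →+* ComplOrder Q Λ P :=
  (Algebra.TensorProduct.map (locRToComplR Q P) (AlgHom.id R Λ)).toRingHom

/-- The canonical homomorphism `Λ → Λ̂_P`. -/
def toComplOrder (Λ : Subalgebra R A) (P : HeightOneSpectrum R) : Λ →+* ComplOrder Q Λ P :=
  (Algebra.TensorProduct.includeRight : Λ →ₐ[R] ComplR Q P ⊗[R] Λ).toRingHom

/-- The reduced points of the torsionfree part of the Ziegler spectrum of `Λ_P`. -/
def ZgTfRedLoc (Λ : Subalgebra R A) (P : HeightOneSpectrum R) :
    Set (RightModClass.{u, w} (LocOrder Λ P)) :=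
  ZgTf (LocR P) (LocOrder Λ P) ∩ Red (LocOrder Λ P) P.asIdeal

/-- The reduced points of the torsionfree part of the Ziegler spectrum of `Λ̂_P`. -/
def ZgTfRedCompl (Λ : Subalgebra R A) (P : HeightOneSpectrum R) :
    Set (RightModClass.{u, w} (ComplOrder Q Λ P)) :=
  ZgTf (ComplR Q P) (ComplOrder Q Λ P) ∩ Red (ComplOrder Q Λ P) P.asIdeal

end Local

end

end OrderZiegler

open OrderZiegler

/-!
Let `Γ` be `Λ` with the opposite multiplication, so that right `Λ`-modules are `Γ`-modules. The idea
is to describe every set in the theorem inside the modules over `Λ`: the reduced points over `Λ_P`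
and over `Λ̂_P` both restrict bijectively onto the torsionfree points over `Λ` that are reduced
at `P` (`image_res_toLocOrder`, `image_res_toComplOrder`), and the points over `A` restrict
bijectively onto the divisible ones.

*Restriction loses nothing.* Call a module `N` over the target of `S → S'` rigid if all `S`-linear
maps from `S'`-modules to `N` are `S'`-linear (`IsRigid`). For rigid modules, being indecomposable
or pure-injective and the isomorphism type do not depend on the choice of `S` or `S'`; that
pure-injectivity restricts rests on its description by algebraic compactness, the solvability of
finitely solvable systems of linear equations (`isPureInjective_iff_isAlgCompact`). All modules over
a ring of fractions are rigid (`isRigid_of_fractions`), and so are the modules over `Λ̂_P` that are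
reduced at `P`, since a `Λ`-linear map is continuous for the `P`-adic topology
(`IsAdicExtension.isRigid`).

*Restriction reaches everything.* Over `R`, algebraic compactness provides common points of cosets
of submodules `N I` with the finite intersection property. It gives, for each `P`, a decomposition
of every element of `N` into one divisible by all elements outside `P` and one in `⋂ N Pⁿ`
(`IsAlgCompact.exists_decomposition`). So if `N` is reduced at `P`, the elements outside `P` act
bijectively, and `N` is a `Λ_P`-module (`exists_module_of_fractions`); algebraic compactness also
provides the limits that make it a `Λ̂_P`-module (`IsAdicExtension.exists_module`).

*The dichotomy.* The divisible part of a torsionfree module is a module over the semisimple algebra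
`A`, and it is an injective `Γ`-module (`baer_of_divisible`), hence a direct summand. If `N` is
indecomposable and not divisible, its divisible part vanishes; the decompositions above are then
direct, so that for every `P` either `⋂ N Pⁿ = 0` or `N = N P`. The second alternative cannot hold
for all `P`, as `N` would be divisible (`IsIndecomposable.reduced_or_divisible`).
-/

namespace OrderZiegler

/-! ### Algebraic compactness -/

/-- `N` is algebraically compact: a system of linear equations over `S`, in arbitrarily many
unknowns but with finitely many unknowns in each equation, has a solution in `N` as soon as each of
its finite subsystems has one. Unknowns are indexed by `I`, equations by `J`; the index types are
bounded by the universe in which pure-injectivity is tested. -/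
def IsAlgCompact (S : Type u) [Ring S] (N : Type v) [AddCommGroup N] [Module S N] : Prop :=
  ∀ (I J : Type (max u v)) (a : J → I →₀ S) (b : J → N),
    (∀ F : Finset J, ∃ x : I → N, ∀ j ∈ F, Finsupp.linearCombination S x (a j) = b j) →
      ∃ x : I → N, ∀ j, Finsupp.linearCombination S x (a j) = b j

/-- Purity of an embedding, for finite subsystems of an arbitrary system. -/
theorem IsPureEmbedding.exists_solution {S : Type u} [Ring S] {X Y : Type v} [AddCommGroup X]
    [Module S X] [AddCommGroup Y] [Module S Y] {f : X →ₗ[S] Y} (hf : IsPureEmbedding f)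
    {I J : Type*} (a : J → I →₀ S) (b : J → X) (y : I → Y)
    (hy : ∀ j, Finsupp.linearCombination S y (a j) = f (b j)) (F : Finset J) :
    ∃ x : I → X, ∀ j ∈ F, Finsupp.linearCombination S x (a j) = b j := by
  classical
  set G : Finset I := F.biUnion fun j => (a j).support with hG
  have key : ∀ {Z : Type v} [AddCommGroup Z] [Module S Z] (z : I → Z), ∀ j ∈ F,
      Finsupp.linearCombination S z (a j)
        = ∑ k : Fin G.card, a j (G.equivFin.symm k) • z (G.equivFin.symm k) := by
    intro Z _ _ z j hj
    rw [Finsupp.linearCombination_apply, Finsupp.sum_of_support_subset (s := G) _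
      (Finset.subset_biUnion_of_mem (fun j => (a j).support) hj) _ (by simp),
      ← Finset.sum_coe_sort]
    exact (Equiv.sum_comp G.equivFin.symm fun i : G => a j i • z i).symm
  obtain ⟨x, hx⟩ := hf F.card G.card
    (fun i k => a (F.equivFin.symm i) (G.equivFin.symm k)) (fun i => b (F.equivFin.symm i))
    ⟨fun k => y (G.equivFin.symm k), fun i => by
      rw [← key y _ (F.equivFin.symm i).2, hy]⟩
  refine ⟨fun i => if h : i ∈ G then x (G.equivFin ⟨i, h⟩) else 0, fun j hj => ?_⟩
  rw [key _ j hj]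
  have := hx (F.equivFin ⟨j, hj⟩)
  simpa using this

theorem IsAlgCompact.isPureInjective {S : Type u} [Ring S] {N : Type v} [AddCommGroup N]
    [Module S N] (h : IsAlgCompact S N) : IsPureInjective S N := by
  classical
  intro X Y _ _ _ _ f hf g
  -- The unknowns are the values of the extension; the equations say that it is additive and
  -- homogeneous, and that it restricts to `g`.
  let a : (Y × Y) ⊕ (S × Y) ⊕ X → Y →₀ S
    | .inl p => Finsupp.single (p.1 + p.2) 1 - Finsupp.single p.1 1 - Finsupp.single p.2 1
    | .inr (.inl p) => Finsupp.single (p.1 • p.2) 1 - Finsupp.single p.2 p.1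
    | .inr (.inr x) => Finsupp.single (f x) 1
  let b : (Y × Y) ⊕ (S × Y) ⊕ X → X
    | .inl _ => 0
    | .inr (.inl _) => 0
    | .inr (.inr x) => x
  obtain ⟨x, hx⟩ := h Y ((Y × Y) ⊕ (S × Y) ⊕ X) a (fun j => g (b j)) (fun F => by
    obtain ⟨x, hx⟩ := hf.exists_solution a b id (by
      rintro (p | p | x) <;> simp [a, b]) F
    refine ⟨g ∘ x, fun j hj => ?_⟩
    rw [← hx j hj, ← LinearMap.map_finsupp_linearCombination])
  refine ⟨{ toFun := x, map_add' := fun y z => ?_, map_smul' := fun s y => ?_ }, ?_⟩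
  · have := hx (.inl (y, z))
    simp only [a, b, map_sub, Finsupp.linearCombination_single, one_smul, map_zero] at this
    rwa [sub_sub, sub_eq_zero] at this
  · have := hx (.inr (.inl (s, y)))
    simp only [a, b, map_sub, Finsupp.linearCombination_single, one_smul, map_zero] at this
    rwa [sub_eq_zero] at this
  · ext z
    simpa [a, b] using hx (.inr (.inr z))

theorem IsPureInjective.isAlgCompact {S : Type u} [Ring S] {N : Type v} [AddCommGroup N]
    [Module S N] (h : IsPureInjective S N) : IsAlgCompact S N := by
  classical
  intro I J a b hab
  -- Adjoin a universal solution of the system to `N`; finite solvability makes this a pure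
  -- extension, and a retraction onto `N` carries the universal solution to a solution in `N`.
  let Z := ULift.{max u v} N × (I →₀ S)
  let c : J → Z := fun j => (-ULift.up (b j), a j)
  let W : Submodule S Z := LinearMap.range (Finsupp.linearCombination S c)
  let f : ULift.{max u v} N →ₗ[S] Z ⧸ W := W.mkQ ∘ₗ LinearMap.inl S _ _
  have hf : IsPureEmbedding f := by
    rintro m n s d ⟨y, hy⟩
    choose z hz using fun k => W.mkQ_surjective (y k)
    have hW : ∀ i, ∑ k, s i k • z k - (d i, 0) ∈ W := fun i => by
      rw [← Submodule.ker_mkQ W, LinearMap.mem_ker, map_sub, map_sum, sub_eq_zero]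
      simp only [map_smul, hz]
      exact hy i
    choose e he using hW
    obtain ⟨x, hx⟩ := hab (Finset.univ.biUnion fun i => (e i).support)
    -- Evaluation at a solution of the finitely many relations involved.
    let ψ : Z →ₗ[S] N :=
      ULift.moduleEquiv.toLinearMap.coprod (Finsupp.linearCombination S x)
    have hψ_apply : ∀ p : Z, ψ p = p.1.down + Finsupp.linearCombination S x p.2 := fun _ => rfl
    have hψ : ∀ i, ψ (Finsupp.linearCombination S c (e i)) = 0 := fun i => by
      rw [Finsupp.linearCombination_apply, Finsupp.sum, map_sum]
      refine Finset.sum_eq_zero fun j hj => ?_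
      have := hx j (Finset.mem_biUnion.2 ⟨i, Finset.mem_univ _, hj⟩)
      rw [map_smul, hψ_apply, this, ULift.neg_down, neg_add_cancel, smul_zero]
    refine ⟨fun k => ULift.up (ψ (z k)), fun i => ?_⟩
    have := hψ i
    rw [he, map_sub, map_sum, sub_eq_zero] at this
    apply ULift.down_injective
    rw [hψ_apply, map_zero, add_zero] at this
    rw [← this]
    simp only [map_smul]
    exact map_sum (ULift.moduleEquiv (R := S) (M := N)) _ _
  obtain ⟨g, hg⟩ := h _ _ f hf ULift.moduleEquiv.toLinearMap
  refine ⟨fun i => g (W.mkQ (0, Finsupp.single i 1)), fun j => ?_⟩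
  have h1 : Finsupp.linearCombination S (fun i => g (W.mkQ (0, Finsupp.single i 1))) (a j)
      = g (W.mkQ (0, a j)) := by
    let k : (I →₀ S) →ₗ[S] N := g ∘ₗ W.mkQ ∘ₗ LinearMap.inr S _ _
    change _ = k (a j)
    congr 1
    ext i
    simp only [LinearMap.comp_apply, Finsupp.lsingle_apply, Finsupp.linearCombination_single,
      one_smul]
    rfl
  rw [h1]
  have h2 : W.mkQ (0, a j) = W.mkQ (ULift.up (b j), 0) := by
    rw [← sub_eq_zero, ← map_sub, ← LinearMap.mem_ker, Submodule.ker_mkQ]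
    refine ⟨Finsupp.single j 1, ?_⟩
    rw [Finsupp.linearCombination_single, one_smul]
    exact Prod.ext (zero_sub _).symm (sub_zero _).symm
  rw [h2]
  exact LinearMap.congr_fun hg (ULift.up (b j))

theorem isPureInjective_iff_isAlgCompact {S : Type u} [Ring S] {N : Type v} [AddCommGroup N]
    [Module S N] : IsPureInjective S N ↔ IsAlgCompact S N :=
  ⟨IsPureInjective.isAlgCompact, IsAlgCompact.isPureInjective⟩

/-- Algebraic compactness passes to scalars acting through a ring homomorphism `φ`: a system over
the source of `φ` is a system over the target. The identification `e` of the underlying groups lets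
the two modules have different carriers. -/
theorem IsAlgCompact.of_semilinear {S S' : Type u} [Ring S] [Ring S'] (φ : S →+* S')
    {M N : Type v} [AddCommGroup M] [Module S M] [AddCommGroup N] [Module S' N] (e : M ≃+ N)
    (he : ∀ s m, e (s • m) = φ s • e m) (h : IsAlgCompact S' N) : IsAlgCompact S M := by
  intro I J a b hab
  have key : ∀ (x : I → M) (c : I →₀ S), Finsupp.linearCombination S' (fun i => e (x i))
      (c.mapRange φ (map_zero φ)) = e (Finsupp.linearCombination S x c) := by
    intro x c
    rw [Finsupp.linearCombination_apply, Finsupp.linearCombination_apply,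
      Finsupp.sum_mapRange_index (by simp), Finsupp.sum, Finsupp.sum, map_sum]
    simp [he]
  obtain ⟨x, hx⟩ := h I J (fun j => (a j).mapRange φ (map_zero φ)) (fun j => e (b j))
    (fun F => by
      obtain ⟨x, hx⟩ := hab F
      exact ⟨fun i => e (x i), fun j hj => by rw [key, hx j hj]⟩)
  refine ⟨fun i => e.symm (x i), fun j => e.injective ?_⟩
  rw [← key, ← hx j]
  simp

/-- In an algebraically compact module over a commutative ring, cosets of the submodules `Iⱼ N` with
`Iⱼ` finitely generated have a common point if any finitely many of them do. -/
theorem IsAlgCompact.exists_forall_sub_mem {R : Type u} [CommRing R] {N : Type v} [AddCommGroup N]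
    [Module R N] (h : IsAlgCompact R N) {J : Type u} (c : J → N) (I : J → Ideal R)
    (hI : ∀ j, (I j).FG)
    (hfin : ∀ F : Finset J, ∃ y, ∀ j ∈ F, y - c j ∈ I j • (⊤ : Submodule R N)) :
    ∃ y, ∀ j, y - c j ∈ I j • (⊤ : Submodule R N) := by
  classical
  choose G hG using hI
  have mem_iff : ∀ j (v : N), v ∈ I j • (⊤ : Submodule R N) ↔
      ∃ z : R → N, ∑ g ∈ G j, g • z g = v := by
    intro j v
    constructor
    · intro hv
      rw [← hG j] at hv
      refine Submodule.smul_induction_on hv (fun r hr n _ => ?_) ?_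
      · obtain ⟨f, hf⟩ := (Submodule.mem_span_finset').1 hr
        refine ⟨fun g => if hg : g ∈ G j then f ⟨g, hg⟩ • n else 0, ?_⟩
        rw [← hf, Finset.sum_smul, ← Finset.sum_coe_sort]
        refine Finset.sum_congr rfl fun g _ => ?_
        simp [smul_smul, mul_comm]
      · rintro x y ⟨z, rfl⟩ ⟨z', rfl⟩
        exact ⟨z + z', by simp [Finset.sum_add_distrib]⟩
    · rintro ⟨z, rfl⟩
      refine Submodule.sum_mem _ fun g hg => Submodule.smul_mem_smul ?_ trivial
      rw [← hG j]
      exact Submodule.subset_span hg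
  -- The unknown `none` is the common point `y`; the unknowns `(j, g)` express `y - c j` through the
  -- generators `g` of `I j`.
  let a : J → Option (J × R) →₀ R := fun j =>
    Finsupp.single none 1 - ∑ g ∈ G j, Finsupp.single (some (j, g)) g
  have ha : ∀ (x : Option (J × R) → N) j, Finsupp.linearCombination R x (a j)
      = x none - ∑ g ∈ G j, g • x (some (j, g)) := by
    intro x j
    simp [a, map_sub, map_sum]
  obtain ⟨x, hx⟩ := h (ULift.{max u v} (Option (J × R))) (ULift.{max u v} J)
    (fun j => (a j.down).mapDomain ULift.up) (fun j => c j.down) (fun F => by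
      obtain ⟨y, hy⟩ := hfin (F.image ULift.down)
      have : ∀ j, ∃ z : R → N, j ∈ F.image ULift.down → ∑ g ∈ G j, g • z g = y - c j := by
        intro j
        by_cases hj : j ∈ F.image ULift.down
        · obtain ⟨z, hz⟩ := (mem_iff j _).1 (hy j hj)
          exact ⟨z, fun _ => hz⟩
        · exact ⟨0, fun h => absurd h hj⟩
      choose z hz using this
      refine ⟨fun i => i.down.elim y fun p => z p.1 p.2, fun j hj => ?_⟩
      rw [Finsupp.linearCombination_mapDomain, ha]
      simp only [Function.comp_apply, Option.elim]
      rw [hz j.down (Finset.mem_image_of_mem _ hj), sub_sub_cancel])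
  refine ⟨x ⟨none⟩, fun j => (mem_iff j _).2 ⟨fun g => x ⟨some (j, g)⟩, ?_⟩⟩
  have := hx ⟨j⟩
  rw [Finsupp.linearCombination_mapDomain, ha] at this
  simp only [Function.comp_apply] at this
  rw [← this, sub_sub_cancel]

/-! ### Rigid modules and change of rings -/

theorem isIndecomposable_iff_isIdempotentElem {S : Type u} [Ring S] {N : Type v} [AddCommGroup N]
    [Module S N] : IsIndecomposable S N ↔
      Nontrivial N ∧ ∀ e : Module.End S N, IsIdempotentElem e → e = 0 ∨ e = 1 := by
  refine and_congr_right fun _ => ⟨fun h e he => ?_, fun h X Y hXY => ?_⟩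
  · rcases h _ _ (LinearMap.IsIdempotentElem.isCompl he) with h | h
    · exact Or.inl (LinearMap.range_eq_bot.1 h)
    · refine Or.inr (LinearMap.ext fun x => ?_)
      have hx : e x - x ∈ LinearMap.ker e := by
        rw [LinearMap.mem_ker, map_sub, sub_eq_zero]
        exact LinearMap.congr_fun he x
      rw [h, Submodule.mem_bot, sub_eq_zero] at hx
      exact hx
  · rcases h _ (Submodule.isIdempotentElem_projection hXY) with h | h
    · left
      rw [← Submodule.range_projection hXY, h, LinearMap.range_zero]
    · right
      rw [← Submodule.ker_projection hXY, h]
      exact LinearMap.ker_id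

/-- A module `N` over the target of `φ : S → S'` is rigid if every `S`-linear map from an
`S'`-module to `N` is already `S'`-linear. For rigid modules, endomorphisms and extension problems
are the same over `S` and over `S'`. The sources range over the universe in which pure-injectivity
of `N` is tested. -/
def IsRigid {S S' : Type u} [Ring S] [Ring S'] (φ : S →+* S') (N : Type v) [AddCommGroup N]
    [Module S' N] : Prop :=
  ∀ (Y : Type (max u v)) [AddCommGroup Y] [Module S' Y] (h : Y →+ N),
    (∀ (s : S) (y : Y), h (φ s • y) = φ s • h y) → ∀ (t : S') (y : Y), h (t • y) = t • h y

theorem isRigid_id {S : Type u} [Ring S] (N : Type v) [AddCommGroup N] [Module S N] :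
    IsRigid (RingHom.id S) N :=
  fun _ _ _ _ h => h

section Transfer

variable {S S' : Type u} [Ring S] [Ring S'] {φ : S →+* S'} {M N : Type v} [AddCommGroup M]
  [Module S M] [AddCommGroup N] [Module S' N]

/-- Rigidity for sources in the universe of `N` itself. -/
theorem IsRigid.map_smul (hN : IsRigid φ N) {Y : Type v} [AddCommGroup Y] [Module S' Y]
    (h : Y →+ N) (hh : ∀ s y, h (φ s • y) = φ s • h y) (t : S') (y : Y) :
    h (t • y) = t • h y :=
  hN (ULift.{max u v} Y) (h.comp (AddEquiv.ulift : ULift.{max u v} Y ≃+ Y).toAddMonoidHom)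
    (fun s y => hh s y.down) t ⟨y⟩

theorem IsRigid.isIndecomposable_iff (hN : IsRigid φ N) (e : M ≃+ N)
    (he : ∀ s m, e (s • m) = φ s • e m) : IsIndecomposable S M ↔ IsIndecomposable S' N := by
  have he' : ∀ s n, e.symm (φ s • n) = s • e.symm n := fun s n => by
    rw [AddEquiv.symm_apply_eq, he, e.apply_symm_apply]
  rw [isIndecomposable_iff_isIdempotentElem, isIndecomposable_iff_isIdempotentElem]
  refine and_congr e.toEquiv.nontrivial_congr ⟨fun h p hp => ?_, fun h p hp => ?_⟩
  · let q : Module.End S M :=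
      { toFun := fun m => e.symm (p (e m))
        map_add' := by simp
        map_smul' := fun s m => by simp [he, he'] }
    have hq : IsIdempotentElem q := LinearMap.ext fun m => by
      have := LinearMap.congr_fun hp (e m)
      simpa [q] using this
    rcases h q hq with h | h
    · refine Or.inl (LinearMap.ext fun n => ?_)
      simpa [q] using LinearMap.congr_fun h (e.symm n)
    · refine Or.inr (LinearMap.ext fun n => ?_)
      simpa [q] using LinearMap.congr_fun h (e.symm n)
  · let q₀ : N →+ N := e.toAddMonoidHom.comp (p.toAddMonoidHom.comp e.symm.toAddMonoidHom)
    let q : Module.End S' N :=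
      { q₀ with
        map_smul' := hN.map_smul q₀ fun s n => by simp [q₀, he, he'] }
    have hq_apply : ∀ n, q n = e (p (e.symm n)) := fun _ => rfl
    have hq : IsIdempotentElem q := LinearMap.ext fun n => by
      have := LinearMap.congr_fun hp (e.symm n)
      rw [Module.End.mul_apply] at this
      rw [Module.End.mul_apply, hq_apply, hq_apply, e.symm_apply_apply, this]
    rcases h q hq with h | h
    · refine Or.inl (LinearMap.ext fun m => e.injective ?_)
      simpa [hq_apply] using LinearMap.congr_fun h (e m)
    · refine Or.inr (LinearMap.ext fun m => e.injective ?_)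
      simpa [hq_apply] using LinearMap.congr_fun h (e m)

theorem IsRigid.isPureInjective_iff (hN : IsRigid φ N) (e : M ≃+ N)
    (he : ∀ s m, e (s • m) = φ s • e m) : IsPureInjective S M ↔ IsPureInjective S' N := by
  refine ⟨fun h X Y _ _ _ _ f hf g => ?_,
    fun h => (h.isAlgCompact.of_semilinear φ e he).isPureInjective⟩
  have he' : ∀ s n, e.symm (φ s • n) = s • e.symm n := fun s n => by
    rw [AddEquiv.symm_apply_eq, he, e.apply_symm_apply]
  let _ : Module S X := Module.compHom X φ
  let _ : Module S Y := Module.compHom Y φ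
  let f' : X →ₗ[S] Y := { f with map_smul' := fun s x => f.map_smul (φ s) x }
  let g' : X →ₗ[S] M :=
    { e.symm.toAddMonoidHom.comp g.toAddMonoidHom with
      map_smul' := fun s x => by
        change e.symm (g (φ s • x)) = s • e.symm (g x)
        rw [g.map_smul, he'] }
  obtain ⟨k, hk⟩ := h X Y f' (fun m n a b hab => hf m n (fun i j => φ (a i j)) b hab) g'
  refine ⟨{ e.toAddMonoidHom.comp k.toAddMonoidHom with
    map_smul' := hN Y (e.toAddMonoidHom.comp k.toAddMonoidHom) fun s y => ?_ }, ?_⟩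
  · exact (congrArg e (k.map_smul s y)).trans (he s _)
  · ext x
    have : k (f x) = e.symm (g x) := LinearMap.congr_fun hk x
    exact (congrArg e this).trans (e.apply_symm_apply _)

theorem isTorsionfreeOver_iff {R : Type u} [CommRing R] [Algebra R S] [Algebra R S']
    (hφ : ∀ r, φ (algebraMap R S r) = algebraMap R S' r) (e : M ≃+ N)
    (he : ∀ s m, e (s • m) = φ s • e m) :
    IsTorsionfreeOver R S M ↔ IsTorsionfreeOver R S' N := by
  refine forall₂_congr fun r _ => ?_
  rw [e.toEquiv.forall_congr_left]
  refine forall_congr' fun n => ?_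
  have : e (algebraMap R S r • e.symm n) = algebraMap R S' r • n := by
    rw [he, hφ, e.apply_symm_apply]
  rw [← this]
  simp

/-- The submodule `N I` does not depend on the ring of scalars containing `R`: it is the additive
subgroup generated by the products `r y`. -/
theorem mem_idealMul_iff {R : Type u} [CommRing R] [Algebra R S] (I : Ideal R) (x : M) :
    x ∈ idealMul S I M ↔
      x ∈ AddSubgroup.closure {x : M | ∃ r ∈ I, ∃ y : M, x = algebraMap R S r • y} := by
  constructor
  · intro hx
    induction hx using Submodule.span_induction with
    | mem x hx => exact AddSubgroup.subset_closure hx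
    | zero => exact zero_mem _
    | add x y _ _ hx hy => exact add_mem hx hy
    | smul s x hx' hx =>
      clear hx'
      induction hx using AddSubgroup.closure_induction with
      | mem x hx =>
        obtain ⟨r, hr, y, rfl⟩ := hx
        refine AddSubgroup.subset_closure ⟨r, hr, s • y, ?_⟩
        rw [smul_smul, smul_smul, Algebra.commutes]
      | zero => simp
      | add x y _ _ hx hy => rw [smul_add]; exact add_mem hx hy
      | neg x _ hx => rw [smul_neg]; exact neg_mem hx
  · intro hx
    have : AddSubgroup.closure {x : M | ∃ r ∈ I, ∃ y : M, x = algebraMap R S r • y}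
        ≤ (idealMul S I M).toAddSubgroup := (AddSubgroup.closure_le _).2 Submodule.subset_span
    exact this hx

theorem isReducedAt_iff {R : Type u} [CommRing R] [Algebra R S] [Algebra R S']
    (hφ : ∀ r, φ (algebraMap R S r) = algebraMap R S' r) (e : M ≃+ N)
    (he : ∀ s m, e (s • m) = φ s • e m) (P : Ideal R) :
    IsReducedAt S P M ↔ IsReducedAt S' P N := by
  have key : ∀ (I : Ideal R) (m : M), m ∈ idealMul S I M ↔ e m ∈ idealMul S' I N := by
    intro I m
    rw [mem_idealMul_iff, mem_idealMul_iff]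
    have : {x : N | ∃ r ∈ I, ∃ y : N, x = algebraMap R S' r • y}
        = e.toAddMonoidHom '' {x : M | ∃ r ∈ I, ∃ y : M, x = algebraMap R S r • y} := by
      ext x
      constructor
      · rintro ⟨r, hr, y, rfl⟩
        exact ⟨_, ⟨r, hr, e.symm y, rfl⟩, by simp [he, hφ]⟩
      · rintro ⟨_, ⟨r, hr, y, rfl⟩, rfl⟩
        exact ⟨r, hr, e y, by simp [he, hφ]⟩
    rw [this, ← AddMonoidHom.map_closure]
    exact (AddSubgroup.mem_map_iff_mem (f := e.toAddMonoidHom) e.injective).symm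
  unfold IsReducedAt
  rw [Submodule.eq_bot_iff, Submodule.eq_bot_iff, e.toEquiv.forall_congr_left]
  refine forall_congr' fun n => ?_
  simp [Submodule.mem_iInf, key]

end Transfer

/-- Torsionfreeness does not distinguish `R` from an `R`-algebra `T` in which every nonzero element
divides a nonzero element of `R`. -/
theorem isTorsionfreeOver_iff_of_dvd {R T S : Type u} [CommRing R] [CommRing T] [Ring S]
    [Algebra R T] [Algebra T S] [Algebra R S] [IsScalarTower R T S] {N : Type v} [AddCommGroup N]
    [Module S N] (hinj : Function.Injective (algebraMap R T))
    (hdvd : ∀ t : T, t ≠ 0 → ∃ r : R, r ≠ 0 ∧ t ∣ algebraMap R T r) :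
    IsTorsionfreeOver T S N ↔ IsTorsionfreeOver R S N := by
  constructor
  · intro h r hr x hx
    refine h (algebraMap R T r) ?_ x ?_
    · rwa [Ne, map_eq_zero_iff _ hinj]
    · rwa [← IsScalarTower.algebraMap_apply]
  · intro h t ht x hx
    obtain ⟨r, hr, t', ht'⟩ := hdvd t ht
    refine h r hr x ?_
    rw [IsScalarTower.algebraMap_apply R T S, ht', mul_comm, map_mul, mul_smul, hx, smul_zero]

/-! ### Isomorphism classes -/

theorem cls_eq_iff {S : Type u} [Ring S] {M N : RightMod.{u, w} S} :
    cls M = cls N ↔ Nonempty (M ≃ₗ[Sᵐᵒᵖ] N) := by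
  unfold cls
  rw [Quotient.eq]
  exact ⟨fun ⟨e⟩ => ⟨e.toLinearEquiv⟩, fun ⟨e⟩ => ⟨e.toModuleIso⟩⟩

theorem exists_cls_eq {S : Type u} [Ring S] (c : RightModClass.{u, w} S) :
    ∃ N : RightMod.{u, w} S, cls N = c :=
  Quotient.exists_rep c

section

variable {S : Type u} [Ring S] {N : RightMod.{u, w} S}

theorem cls_mem_Zg_iff :
    cls N ∈ Zg S ↔ IsIndecomposable Sᵐᵒᵖ N ∧ IsPureInjective Sᵐᵒᵖ N := by
  refine ⟨?_, fun h => ⟨N, rfl, h⟩⟩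
  rintro ⟨M, hM, h⟩
  obtain ⟨e⟩ := cls_eq_iff.1 hM
  rwa [(isRigid_id N).isIndecomposable_iff e.toAddEquiv e.map_smul,
    (isRigid_id N).isPureInjective_iff e.toAddEquiv e.map_smul] at h

theorem cls_mem_ZgTf_iff {T : Type u} [CommRing T] [Algebra T S] :
    cls N ∈ ZgTf T S ↔ IsIndecomposable Sᵐᵒᵖ N ∧ IsPureInjective Sᵐᵒᵖ N ∧
      IsTorsionfreeOver T Sᵐᵒᵖ N := by
  refine ⟨?_, fun h => ⟨N, rfl, h⟩⟩
  rintro ⟨M, hM, h⟩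
  obtain ⟨e⟩ := cls_eq_iff.1 hM
  rwa [(isRigid_id N).isIndecomposable_iff e.toAddEquiv e.map_smul,
    (isRigid_id N).isPureInjective_iff e.toAddEquiv e.map_smul,
    isTorsionfreeOver_iff (φ := RingHom.id _) (fun _ => rfl) e.toAddEquiv e.map_smul] at h

theorem cls_mem_Red_iff {R : Type u} [CommRing R] [Algebra R S] {P : Ideal R} :
    cls N ∈ Red S P ↔ IsReducedAt Sᵐᵒᵖ P N := by
  refine ⟨?_, fun h => ⟨N, rfl, h⟩⟩
  rintro ⟨M, hM, h⟩
  obtain ⟨e⟩ := cls_eq_iff.1 hM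
  rwa [isReducedAt_iff (φ := RingHom.id _) (fun _ => rfl) e.toAddEquiv e.map_smul] at h

variable {S' : Type u} [Ring S'] {φ : S →+* S'} {M : RightMod.{u, w} S'}

theorem res_cls : res φ (cls M) = cls ((ModuleCat.restrictScalars (RingHom.op φ)).obj M) := rfl

theorem res_res {S'' : Type u} [Ring S''] (ψ : S' →+* S'') (c : RightModClass.{u, w} S'') :
    res φ (res ψ c) = res (ψ.comp φ) c := by
  obtain ⟨M, rfl⟩ := exists_cls_eq c
  rfl

/-- An isomorphism of a right module with a restriction of scalars, unbundled. -/
theorem res_cls_eq_iff : res φ (cls M) = cls N ↔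
    ∃ e : N ≃+ M, ∀ (s : S) (n : N), e (MulOpposite.op s • n) = MulOpposite.op (φ s) • e n := by
  rw [res_cls, eq_comm, cls_eq_iff]
  constructor
  · rintro ⟨e⟩
    exact ⟨e.toAddEquiv, fun s n => e.map_smul (MulOpposite.op s) n⟩
  · rintro ⟨e, he⟩
    exact ⟨{ e with map_smul' := fun s n => he s.unop n }⟩

theorem exists_res_eq (m : Module S'ᵐᵒᵖ N)
    (hm : ∀ (s : S) (n : N), MulOpposite.op (φ s) • n = MulOpposite.op s • n) :
    ∃ M : RightMod.{u, w} S', res φ (cls M) = cls N :=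
  ⟨ModuleCat.of S'ᵐᵒᵖ N, res_cls_eq_iff.2 ⟨AddEquiv.refl N, fun s n => (hm s n).symm⟩⟩

/-- A rigid module is determined up to isomorphism by its restriction of scalars. -/
theorem cls_eq_of_res_eq {M M' : RightMod.{u, w} S'} (hM : IsRigid (RingHom.op φ) M)
    (h : res φ (cls M) = res φ (cls M')) : cls M = cls M' := by
  obtain ⟨e, he⟩ := res_cls_eq_iff.1 h
  refine (cls_eq_iff.2 ⟨{ e with map_smul' := ?_ }⟩).symm
  exact hM.map_smul e.toAddMonoidHom fun s y => he s.unop y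

end

/-! ### Decomposition of torsionfree algebraically compact modules -/

theorem exists_add_mul_eq_one {R : Type*} [CommRing R] [IsDedekindDomain R]
    (P : HeightOneSpectrum R) {s : R} (hs : s ∉ P.asIdeal) (n : ℕ) :
    ∃ p ∈ P.asIdeal ^ n, ∃ t, p + t * s = 1 := by
  have h1 : P.asIdeal ⊔ Ideal.span {s} = ⊤ := by
    refine P.isMaximal.out.2 _ (lt_of_le_of_ne le_sup_left fun h => hs ?_)
    rw [h]
    exact Ideal.mem_sup_right (Ideal.mem_span_singleton_self s)
  have h2 := (Ideal.eq_top_iff_one _).1 (Ideal.pow_sup_eq_top (n := n) h1)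
  obtain ⟨p, hp, q, hq, hpq⟩ := Submodule.mem_sup.1 h2
  obtain ⟨t, rfl⟩ := Ideal.mem_span_singleton'.1 hq
  exact ⟨p, hp, t, hpq⟩

section Commutative

variable {R : Type u} [CommRing R] {N : Type v} [AddCommGroup N] [Module R N]

theorem mem_span_singleton_smul_top_iff (r : R) (x : N) :
    x ∈ Ideal.span {r} • (⊤ : Submodule R N) ↔ ∃ y, r • y = x := by
  rw [Submodule.ideal_span_singleton_smul, Submodule.mem_smul_pointwise_iff_exists]
  simp

variable [IsDedekindDomain R]

/-- A module that equals `N P` for every maximal ideal `P` is divisible. -/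
theorem exists_smul_eq_of_forall_smul_top_eq
    (h : ∀ P : HeightOneSpectrum R, P.asIdeal • (⊤ : Submodule R N) = ⊤) {r : R} (hr : r ≠ 0)
    (x : N) : ∃ y, r • y = x := by
  have key : ∀ I : Ideal R, I ≠ 0 → I • (⊤ : Submodule R N) = ⊤ := by
    intro I
    induction I using UniqueFactorizationMonoid.induction_on_prime with
    | h₁ => exact fun h => absurd rfl h
    | h₂ I hI => intro _; rw [Ideal.isUnit_iff.1 hI, Submodule.top_smul]
    | h₃ I p hI hp ih =>
      intro _
      rw [Submodule.mul_smul, ih hI]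
      exact h ⟨p, Ideal.isPrime_of_prime hp, hp.ne_zero⟩
  rw [← mem_span_singleton_smul_top_iff, key _ (by simpa using hr)]
  trivial

/-- An element that is divisible by all elements outside `P`, and lies in all `N Pⁿ`, is divisible
by every nonzero element. -/
theorem exists_smul_eq_of_mem_pow (P : HeightOneSpectrum R) {x : N}
    (hK : ∀ s ∉ P.asIdeal, ∃ y, s • y = x)
    (hL : ∀ n : ℕ, x ∈ P.asIdeal ^ n • (⊤ : Submodule R N)) {r : R} (hr : r ≠ 0) :
    ∃ y, r • y = x := by
  have hfin : FiniteMultiplicity P.asIdeal (Ideal.span {r}) :=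
    FiniteMultiplicity.of_prime_left P.prime (by simpa using hr)
  obtain ⟨J, hJ, hPJ⟩ := hfin.exists_eq_pow_mul_and_not_dvd
  rw [Ideal.dvd_iff_le, SetLike.not_le_iff_exists] at hPJ
  obtain ⟨s, hsJ, hs⟩ := hPJ
  obtain ⟨y, rfl⟩ := hK s hs
  obtain ⟨p, hp, t, hpt⟩ := exists_add_mul_eq_one P hs (multiplicity P.asIdeal (Ideal.span {r}))
  have hy : y ∈ P.asIdeal ^ multiplicity P.asIdeal (Ideal.span {r}) • (⊤ : Submodule R N) := by
    have : y = p • y + t • s • y := by rw [smul_smul, ← add_smul, hpt, one_smul]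
    rw [this]
    exact add_mem (Submodule.smul_mem_smul hp trivial) (Submodule.smul_mem _ _ (hL _))
  rw [← mem_span_singleton_smul_top_iff, hJ, mul_comm, Submodule.mul_smul]
  exact Submodule.smul_mem_smul hsJ hy

/-- In an algebraically compact module, every element is the sum of one divisible by all elements
outside `P` and one lying in all `N Pⁿ`: modulo finitely many conditions, multiply by an element of
`R` that is `1` modulo a power of `P` and `0` modulo a given `s ∉ P`. -/
theorem IsAlgCompact.exists_decomposition (hN : IsAlgCompact R N) (P : HeightOneSpectrum R)
    (x : N) : ∃ y, (∀ s ∉ P.asIdeal, ∃ z, s • z = y) ∧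
      ∀ n : ℕ, x - y ∈ P.asIdeal ^ n • (⊤ : Submodule R N) := by
  classical
  let c : P.asIdeal.primeCompl ⊕ ℕ → N := Sum.elim (fun _ => 0) (fun _ => x)
  let I : P.asIdeal.primeCompl ⊕ ℕ → Ideal R :=
    Sum.elim (fun s => Ideal.span {(s : R)}) (fun n => P.asIdeal ^ n)
  obtain ⟨y, hy⟩ := hN.exists_forall_sub_mem c I (fun j => IsNoetherian.noetherian (I j)) (by
    intro F
    let s : R := ((∏ s ∈ F.toLeft, s : P.asIdeal.primeCompl) : R)
    obtain ⟨p, hp, t, hpt⟩ := exists_add_mul_eq_one P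
      (∏ s ∈ F.toLeft, s : P.asIdeal.primeCompl).2 (F.toRight.sup id)
    refine ⟨(t * s) • x, fun j hj => ?_⟩
    rcases j with s' | n
    · change (t * s) • x - 0 ∈ Ideal.span {(s' : R)} • (⊤ : Submodule R N)
      rw [sub_zero]
      refine Submodule.smul_mem_smul (Ideal.mem_span_singleton.2 (Dvd.dvd.mul_left ?_ t)) trivial
      have := Finset.dvd_prod_of_mem (fun s : P.asIdeal.primeCompl => s)
        (Finset.mem_toLeft.2 hj)
      exact map_dvd P.asIdeal.primeCompl.subtype this
    · change (t * s) • x - x ∈ P.asIdeal ^ n • (⊤ : Submodule R N)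
      have hn : n ≤ F.toRight.sup id := Finset.le_sup (f := id) (Finset.mem_toRight.2 hj)
      have : (t * s) • x - x = (-p) • x := by
        rw [eq_sub_of_add_eq' hpt, sub_smul, one_smul, neg_smul]
        abel
      rw [this]
      exact Submodule.smul_mem_smul (neg_mem (Ideal.pow_le_pow_right hn hp)) trivial)
  refine ⟨y, fun s hs => ?_, fun n => ?_⟩
  · have := hy (.inl ⟨s, hs⟩)
    rw [← mem_span_singleton_smul_top_iff]
    simpa [c, I] using this
  · have := neg_mem (hy (.inr n))
    rwa [neg_sub] at this

end Commutative

/-- A module over an `R`-algebra is an `R`-module. -/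
theorem exists_compatible_module (R : Type*) [CommRing R] (Γ : Type*) [Ring Γ] [Algebra R Γ]
    (N : Type*) [AddCommGroup N] [Module Γ N] : ∃ _ : Module R N, IsScalarTower R Γ N := by
  let _ : Module R N := Module.compHom N (algebraMap R Γ)
  exact ⟨inferInstance, ⟨fun r γ x => by rw [Algebra.smul_def, mul_smul]; rfl⟩⟩

section Order

variable {R : Type u} [CommRing R] {Γ : Type u} [Ring Γ] [Algebra R Γ] {N : Type v}
  [AddCommGroup N] [Module R N] [Module Γ N] [IsScalarTower R Γ N]

/-- The elements of `N` that are divisible by all `s ∈ M`; a `Γ`-submodule as `Γ` commutes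
with `R`. -/
def divisibleBy (Γ : Type u) [Ring Γ] [Algebra R Γ] (N : Type v) [AddCommGroup N] [Module R N]
    [Module Γ N] [IsScalarTower R Γ N] (M : Set R) : Submodule Γ N where
  carrier := {x | ∀ s ∈ M, ∃ y, s • y = x}
  add_mem' := fun {x x'} h h' s hs => by
    obtain ⟨y, hy⟩ := h s hs
    obtain ⟨y', hy'⟩ := h' s hs
    exact ⟨y + y', by rw [smul_add, hy, hy']⟩
  zero_mem' := fun s _ => ⟨0, smul_zero s⟩
  smul_mem' := fun γ x h s hs => by
    obtain ⟨y, hy⟩ := h s hs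
    exact ⟨γ • y, by rw [smul_comm, hy]⟩

theorem smul_mem_smul_top (γ : Γ) (I : Ideal R) {x : N} (hx : x ∈ I • (⊤ : Submodule R N)) :
    γ • x ∈ I • (⊤ : Submodule R N) := by
  refine Submodule.smul_induction_on hx (fun r hr y _ => ?_) fun x y hx hy => ?_
  · rw [smul_comm]
    exact Submodule.smul_mem_smul hr trivial
  · rw [smul_add]
    exact add_mem hx hy

/-- The intersection of all `N Pⁿ`, as a `Γ`-submodule. -/
def infPow (Γ : Type u) [Ring Γ] [Algebra R Γ] (N : Type v) [AddCommGroup N] [Module R N]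
    [Module Γ N] [IsScalarTower R Γ N] (P : Ideal R) : Submodule Γ N where
  carrier := {x | ∀ n : ℕ, x ∈ P ^ n • (⊤ : Submodule R N)}
  add_mem' := fun h h' n => add_mem (h n) (h' n)
  zero_mem' := fun _ => zero_mem _
  smul_mem' := fun γ _ h n => smul_mem_smul_top γ _ (h n)

theorem mem_infPow {P : Ideal R} {x : N} :
    x ∈ infPow Γ N P ↔ ∀ n : ℕ, x ∈ P ^ n • (⊤ : Submodule R N) := Iff.rfl

theorem isReducedAt_iff_infPow {P : Ideal R} : IsReducedAt Γ P N ↔ infPow Γ N P = ⊥ := by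
  have key : ∀ (I : Ideal R) (x : N), x ∈ idealMul Γ I N ↔ x ∈ I • (⊤ : Submodule R N) := by
    intro I x
    constructor
    · intro hx
      refine Submodule.span_induction ?_ (zero_mem _) (fun _ _ _ _ => add_mem)
        (fun γ _ _ h => smul_mem_smul_top γ I h) hx
      rintro _ ⟨r, hr, y, rfl⟩
      rw [algebraMap_smul]
      exact Submodule.smul_mem_smul hr trivial
    · intro hx
      refine Submodule.smul_induction_on hx (fun r hr y _ => ?_) fun _ _ => add_mem
      exact Submodule.subset_span ⟨r, hr, y, (algebraMap_smul Γ r y).symm⟩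
  unfold IsReducedAt
  rw [Submodule.eq_bot_iff, Submodule.eq_bot_iff]
  refine forall_congr' fun x => ?_
  simp [Submodule.mem_iInf, key, mem_infPow]

/-- A pure-injective module over an `R`-algebra is algebraically compact over `R`. -/
theorem IsPureInjective.isAlgCompact_of_algebra (hN : IsPureInjective Γ N) : IsAlgCompact R N :=
  hN.isAlgCompact.of_semilinear (algebraMap R Γ) (AddEquiv.refl N) fun r x =>
    (algebraMap_smul Γ r x).symm

/-- A nonzero module on which some element of `P` acts surjectively is not reduced at `P`. -/
theorem IsReducedAt.subsingleton {I : Ideal R} (hred : IsReducedAt Γ I N) {s : R} (hs : s ∈ I)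
    (hsurj : ∀ x : N, ∃ y, s • y = x) : Subsingleton N := by
  refine subsingleton_of_forall_eq 0 fun x => ?_
  have hpow : ∀ (n : ℕ) (x : N), ∃ y, s ^ n • y = x := by
    intro n
    induction n with
    | zero => exact fun x => ⟨x, by simp⟩
    | succ n ih =>
      intro x
      obtain ⟨y, rfl⟩ := ih x
      obtain ⟨z, rfl⟩ := hsurj y
      exact ⟨z, by rw [pow_succ, mul_smul]⟩
  have : x ∈ infPow Γ N I := fun n => by
    obtain ⟨y, rfl⟩ := hpow n x
    exact Submodule.smul_mem_smul (Ideal.pow_mem_pow hs n) trivial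
  rwa [isReducedAt_iff_infPow.1 hred, Submodule.mem_bot] at this

theorem isTorsionfreeOver_iff_smul : IsTorsionfreeOver R Γ N ↔
    ∀ r : R, r ≠ 0 → ∀ x : N, r • x = 0 → x = 0 := by
  simp [IsTorsionfreeOver, algebraMap_smul]

/-- In a torsionfree module, the quotients of a divisible element by nonzero elements of `R` are
again divisible. -/
theorem mem_divisibleBy_of_smul_mem [IsDomain R]
    (htf : ∀ r : R, r ≠ 0 → ∀ x : N, r • x = 0 → x = 0) {r : R} (hr : r ≠ 0) {x : N}
    (hx : r • x ∈ divisibleBy Γ N {s : R | s ≠ 0}) : x ∈ divisibleBy Γ N {s : R | s ≠ 0} := by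
  intro s hs
  obtain ⟨y, hy⟩ := hx (r * s) (mul_ne_zero hr hs)
  refine ⟨y, ?_⟩
  rw [← sub_eq_zero]
  refine htf r hr _ ?_
  rw [smul_sub, smul_smul, hy, sub_self]

/-- A divisible torsionfree module over an order in a semisimple algebra `B` is injective. By Baer's
criterion it suffices to extend `g : I → D` from a left ideal `I`. The left ideal `B I` is generated
by an idempotent `e`; if `r e ∈ I` with `r ≠ 0`, then `g` is the action on `r⁻¹ g (r e)`. -/
theorem baer_of_divisible [IsDomain R] {B : Type*} [Ring B] [IsSemisimpleRing B] [Algebra R B]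
    (φ : Γ →ₐ[R] B) (hφ : Function.Injective φ)
    (hfrac : ∀ b : B, ∃ r : R, r ≠ 0 ∧ ∃ γ : Γ, algebraMap R B r * b = φ γ)
    (htf : ∀ r : R, r ≠ 0 → ∀ x : N, r • x = 0 → x = 0)
    (hdiv : ∀ r : R, r ≠ 0 → ∀ x : N, ∃ y, r • y = x) : Module.Baer Γ N := by
  intro I g
  have hJ : ∀ b ∈ Ideal.span (φ '' (I : Set Γ)),
      ∃ r : R, r ≠ 0 ∧ ∃ γ ∈ I, algebraMap R B r * b = φ γ := by
    intro b hb
    induction hb using Submodule.span_induction with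
    | mem b hb =>
      obtain ⟨γ, hγ, rfl⟩ := hb
      exact ⟨1, one_ne_zero, γ, hγ, by simp⟩
    | zero => exact ⟨1, one_ne_zero, 0, zero_mem _, by simp⟩
    | add b b' _ _ h h' =>
      obtain ⟨r, hr, γ, hγ, h⟩ := h
      obtain ⟨r', hr', γ', hγ', h'⟩ := h'
      refine ⟨r' * r, mul_ne_zero hr' hr, r' • γ + r • γ', add_mem (I.smul_of_tower_mem r' hγ)
        (I.smul_of_tower_mem r hγ'), ?_⟩
      rw [map_add, map_smul, map_smul, ← h, ← h', mul_add, Algebra.smul_def, Algebra.smul_def,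
        map_mul, mul_assoc, ← mul_assoc, ← mul_assoc, ← map_mul, ← map_mul, mul_comm r r']
    | smul a b _ h =>
      obtain ⟨r, hr, γ, hγ, h⟩ := h
      obtain ⟨s, hs, δ, hδ⟩ := hfrac a
      refine ⟨s * r, mul_ne_zero hs hr, δ * γ, I.mul_mem_left _ hγ, ?_⟩
      rw [smul_eq_mul, map_mul, map_mul, ← hδ, ← h, mul_assoc, mul_assoc, ← mul_assoc _ a b,
        Algebra.commutes r a, mul_assoc]
  obtain ⟨e, he, hspan⟩ := IsSemisimpleRing.ideal_eq_span_idempotent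
    (Ideal.span (φ '' (I : Set Γ)))
  have hmul : ∀ γ ∈ I, φ γ * e = φ γ := by
    intro γ hγ
    have : φ γ ∈ Ideal.span {e} := hspan ▸ Ideal.subset_span ⟨γ, hγ, rfl⟩
    obtain ⟨b, hb⟩ := Ideal.mem_span_singleton'.1 this
    rw [← hb, mul_assoc, he.eq]
  obtain ⟨r, hr, δ, hδ, hre⟩ := hJ e (hspan ▸ Ideal.mem_span_singleton_self e)
  obtain ⟨d, hd⟩ := hdiv r hr (g ⟨δ, hδ⟩)
  refine ⟨LinearMap.toSpanSingleton Γ N d, fun γ hγ => ?_⟩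
  have h1 : γ * δ = r • γ := hφ <| by
    rw [map_mul, ← hre, map_smul, Algebra.smul_def, ← mul_assoc, ← Algebra.commutes, mul_assoc,
      hmul γ hγ]
  have h2 : r • g ⟨γ, hγ⟩ = r • γ • d := by
    have h3 : algebraMap R Γ r • (⟨γ, hγ⟩ : I) = γ • ⟨δ, hδ⟩ :=
      Subtype.ext <| by simp [h1, Algebra.smul_def]
    rw [smul_comm, hd, ← g.map_smul γ, ← h3, g.map_smul, algebraMap_smul]
  rw [LinearMap.toSpanSingleton_apply, ← sub_eq_zero]
  refine htf r hr _ ?_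
  rw [smul_sub, h2, sub_self]

/-- On an algebraically compact module that is reduced at `P`, all elements outside `P` act
surjectively. -/
theorem IsAlgCompact.exists_smul_eq_of_isReducedAt [IsDedekindDomain R] (hc : IsAlgCompact R N)
    {P : HeightOneSpectrum R} (hred : IsReducedAt Γ P.asIdeal N) {s : R} (hs : s ∉ P.asIdeal)
    (x : N) : ∃ y, s • y = x := by
  obtain ⟨y, hy, hxy⟩ := hc.exists_decomposition P x
  have h0 : x - y ∈ infPow Γ N P.asIdeal := hxy
  rw [isReducedAt_iff_infPow.1 hred, Submodule.mem_bot, sub_eq_zero] at h0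
  rw [h0]
  exact hy s hs

/-- The dichotomy for torsionfree points: the divisible part is a direct summand, and if it
vanishes, then for each `P` the module is the direct sum of the part divisible by all elements
outside `P` and the intersection of the `N Pⁿ`. -/
theorem IsIndecomposable.reduced_or_divisible [IsDedekindDomain R] {B : Type*} [Ring B]
    [IsSemisimpleRing B] [Algebra R B] (φ : Γ →ₐ[R] B) (hφ : Function.Injective φ)
    (hfrac : ∀ b : B, ∃ r : R, r ≠ 0 ∧ ∃ γ : Γ, algebraMap R B r * b = φ γ)
    (hN : IsIndecomposable Γ N) (hc : IsAlgCompact R N)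
    (htf : ∀ r : R, r ≠ 0 → ∀ x : N, r • x = 0 → x = 0) :
    (∃ P : HeightOneSpectrum R, IsReducedAt Γ P.asIdeal N) ∨
      ∀ r : R, r ≠ 0 → ∀ x : N, ∃ y, r • y = x := by
  set D := divisibleBy Γ N {s : R | s ≠ 0} with hD
  have hbaer : Module.Baer Γ D := by
    refine baer_of_divisible φ hφ hfrac (fun r hr x hx => ?_) fun r hr x => ?_
    · exact Subtype.ext (htf r hr x (congrArg Subtype.val hx))
    · obtain ⟨y, hy⟩ := x.2 r hr
      exact ⟨⟨y, mem_divisibleBy_of_smul_mem htf hr (hy ▸ x.2)⟩, Subtype.ext hy⟩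
  obtain ⟨p, hp⟩ := hbaer.extension_property D.subtype D.injective_subtype LinearMap.id
  rcases hN.2 _ _ (LinearMap.isCompl_of_proj fun x => LinearMap.congr_fun hp x) with hbot | hbot
  · have hcompl : ∀ P : HeightOneSpectrum R,
        IsCompl (divisibleBy Γ N {s : R | s ∉ P.asIdeal}) (infPow Γ N P.asIdeal) := by
      intro P
      refine ⟨Submodule.disjoint_def.2 fun x hK hL => ?_, codisjoint_iff.2 ?_⟩
      · have : x ∈ D := fun r hr => exists_smul_eq_of_mem_pow P hK hL hr
        rwa [hbot, Submodule.mem_bot] at this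
      · refine Submodule.eq_top_iff'.2 fun x => ?_
        obtain ⟨y, hy, hxy⟩ := hc.exists_decomposition P x
        exact Submodule.mem_sup.2 ⟨y, hy, x - y, hxy, by abel⟩
    by_cases h : ∃ P : HeightOneSpectrum R, infPow Γ N P.asIdeal = ⊥
    · obtain ⟨P, hP⟩ := h
      exact Or.inl ⟨P, isReducedAt_iff_infPow.2 hP⟩
    · push Not at h
      refine Or.inr fun r hr x => exists_smul_eq_of_forall_smul_top_eq (fun P => ?_) hr x
      have htop := (hcompl P).codisjoint.eq_top
      rw [(hN.2 _ _ (hcompl P)).resolve_right (h P), bot_sup_eq] at htop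
      refine Submodule.eq_top_iff'.2 fun x => ?_
      have : x ∈ infPow Γ N P.asIdeal := htop ▸ Submodule.mem_top
      simpa using this 1
  · refine Or.inr fun r hr x => ?_
    have hx : x - p x ∈ LinearMap.ker p := by
      rw [LinearMap.mem_ker, map_sub, sub_eq_zero]
      exact (LinearMap.congr_fun hp (p x)).symm
    rw [hbot, Submodule.mem_bot, sub_eq_zero] at hx
    exact (hx ▸ (p x).2 : x ∈ D) r hr

end Order

/-! ### Extending the ring of scalars -/

/-- A `T`-module structure on `N` can be given by a relation `ρ t x y`, read `t x = y`. -/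
theorem exists_module_of_relation {T N : Type*} [Ring T] [AddCommGroup N] (ρ : T → N → N → Prop)
    (hex : ∀ t x, ∃ y, ρ t x y) (huniq : ∀ t x y y', ρ t x y → ρ t x y' → y = y')
    (hadd_left : ∀ t t' x y y', ρ t x y → ρ t' x y' → ρ (t + t') x (y + y'))
    (hadd_right : ∀ t x x' y y', ρ t x y → ρ t x' y' → ρ t (x + x') (y + y'))
    (hone : ∀ x, ρ 1 x x) (hmul : ∀ t t' x y z, ρ t' x y → ρ t y z → ρ (t * t') x z) :
    ∃ _ : Module T N, ∀ t x y, ρ t x y → t • x = y := by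
  choose f hf using hex
  let g : T →+* AddMonoid.End N :=
    RingHom.mk'
      { toFun := fun t => AddMonoidHom.mk' (f t) fun x x' =>
          huniq _ _ _ _ (hf _ _) (hadd_right _ _ _ _ _ (hf _ _) (hf _ _))
        map_one' := AddMonoidHom.ext fun x => huniq _ _ _ _ (hf _ _) (hone x)
        map_mul' := fun t t' => AddMonoidHom.ext fun x =>
          huniq _ _ _ _ (hf _ _) (hmul _ _ _ _ _ (hf _ _) (hf _ _)) }
      fun t t' => AddMonoidHom.ext fun x =>
        huniq _ _ _ _ (hf _ _) (hadd_left _ _ _ _ _ (hf _ _) (hf _ _))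
  exact ⟨Module.compHom N g, fun t x y h => huniq _ _ _ _ (hf t x) h⟩

section Localization

variable {R : Type u} [CommRing R] {Γ T : Type u} [Ring Γ] [Ring T] [Algebra R Γ] [Algebra R T]

/-- If `T` is a ring of fractions of `Γ` with denominators in `M ⊆ R`, then a `Γ`-module on which
`M` acts bijectively is a `T`-module. -/
theorem exists_module_of_fractions {N : Type v} [AddCommGroup N] [Module R N] [Module Γ N]
    [IsScalarTower R Γ N] (φ : Γ →ₐ[R] T) (M : Submonoid R)
    (hfrac : ∀ t : T, ∃ s ∈ M, ∃ γ : Γ, algebraMap R T s * t = φ γ)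
    (hker : ∀ γ : Γ, φ γ = 0 → ∃ s ∈ M, s • γ = 0)
    (hinj : ∀ s ∈ M, ∀ x : N, s • x = 0 → x = 0)
    (hsurj : ∀ s ∈ M, ∀ x : N, ∃ y, s • y = x) :
    ∃ _ : Module T N, ∀ (γ : Γ) (x : N), φ γ • x = γ • x := by
  let ρ : T → N → N → Prop := fun t x y =>
    ∃ s ∈ M, ∃ γ : Γ, algebraMap R T s * t = φ γ ∧ s • y = γ • x
  have huniq : ∀ t x y y', ρ t x y → ρ t x y' → y = y' := by
    rintro t x y y' ⟨s, hs, γ, hγ, h⟩ ⟨s', hs', γ', hγ', h'⟩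
    have h0 : φ (s' • γ - s • γ') = 0 := by
      rw [map_sub, map_smul, map_smul, ← hγ, ← hγ', Algebra.smul_def, Algebra.smul_def,
        ← mul_assoc, ← mul_assoc, ← map_mul, ← map_mul, mul_comm, sub_self]
    obtain ⟨s₁, hs₁, h₁⟩ := hker _ h0
    rw [← sub_eq_zero]
    refine hinj (s₁ * (s' * s)) (M.mul_mem hs₁ (M.mul_mem hs' hs)) _ ?_
    rw [mul_smul, smul_sub, mul_smul, h, mul_comm, mul_smul, h', ← smul_assoc, ← smul_assoc,
      ← sub_smul, ← smul_assoc, h₁, zero_smul]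
  obtain ⟨m, hm⟩ := exists_module_of_relation ρ (fun t x => by
      obtain ⟨s, hs, γ, h⟩ := hfrac t
      obtain ⟨y, hy⟩ := hsurj s hs (γ • x)
      exact ⟨y, s, hs, γ, h, hy⟩) huniq
    (by
      rintro t t' x y y' ⟨s, hs, γ, hγ, h⟩ ⟨s', hs', γ', hγ', h'⟩
      refine ⟨s' * s, M.mul_mem hs' hs, s' • γ + s • γ', ?_, ?_⟩
      · rw [map_add, map_smul, map_smul, ← hγ, ← hγ', Algebra.smul_def, Algebra.smul_def,
          ← mul_assoc, ← mul_assoc, ← map_mul, ← map_mul, mul_comm s s', mul_add]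
      · rw [smul_add, add_smul, mul_smul, h, mul_comm, mul_smul, h', smul_assoc, smul_assoc])
    (by
      rintro t x x' y y' ⟨s, hs, γ, hγ, h⟩ ⟨s', hs', γ', hγ', h'⟩
      obtain ⟨z, hz⟩ := hsurj s hs (γ • x')
      have := huniq t x' y' z ⟨s', hs', γ', hγ', h'⟩ ⟨s, hs, γ, hγ, hz⟩
      refine ⟨s, hs, γ, hγ, ?_⟩
      rw [smul_add, smul_add, h, this, hz])
    (fun x => ⟨1, M.one_mem, 1, by simp, by simp⟩)
    (by
      rintro t t' x y z ⟨s', hs', γ', hγ', h'⟩ ⟨s, hs, γ, hγ, h⟩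
      refine ⟨s' * s, M.mul_mem hs' hs, γ * γ', ?_, ?_⟩
      · have hcomm : algebraMap R T s' * t = t * algebraMap R T s' := Algebra.commutes s' t
        rw [map_mul φ, ← hγ, ← hγ', mul_comm s' s, map_mul, mul_assoc, mul_assoc, ← mul_assoc _ t,
          hcomm, mul_assoc]
      · rw [mul_smul, h, smul_comm, h', mul_smul])
  exact ⟨m, fun γ x => hm _ _ _ ⟨1, M.one_mem, γ, by simp, by simp⟩⟩

/-- All modules over a ring of fractions with central denominators are rigid: if `s t` comes from
`Γ`, then `s h (t y) = s t h y`, and `s` can be cancelled. -/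
theorem isRigid_of_fractions {N : Type v} [AddCommGroup N] [Module T N] (φ : Γ →+* T)
    (hφ : ∀ r, φ (algebraMap R Γ r) = algebraMap R T r) (M : Submonoid R)
    (hfrac : ∀ t : T, ∃ s ∈ M, ∃ γ : Γ, algebraMap R T s * t = φ γ)
    (hunit : ∀ s ∈ M, IsUnit (algebraMap R T s)) : IsRigid φ N := by
  intro Y _ _ h hh t y
  obtain ⟨s, hs, γ, hγ⟩ := hfrac t
  have h1 : algebraMap R T s • h (t • y) = algebraMap R T s • t • h y := by
    rw [← hφ, ← hh, hφ, smul_smul, smul_smul, hγ, hh]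
  exact (hunit s hs).smul_left_cancel.1 h1

end Localization

section Completion

variable {R : Type u} [CommRing R] [IsNoetherianRing R] {T : Type u} [CommRing T] [Algebra R T]

/-- `T` behaves like the `P`-adic completion of `R`, with `π ∈ P` generating the maximal ideal:
modulo each power of `π`, every element of `T` comes from `R`, and only the elements of `Pⁿ` become
divisible by `πⁿ` in `T`. -/
structure IsAdicExtension (P : Ideal R) (π : R) (T : Type u) [CommRing T] [Algebra R T] :
    Prop where
  mem : π ∈ P
  exists_eq : ∀ (t : T) (n : ℕ), ∃ (r : R) (t' : T),
    t = algebraMap R T r + algebraMap R T (π ^ n) * t'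
  mem_pow : ∀ (n : ℕ) (r : R) (t : T), algebraMap R T r = algebraMap R T (π ^ n) * t → r ∈ P ^ n

variable {P : Ideal R} {π : R}

/-- An algebraically compact module that is separated for the `P`-adic topology is a module over the
completion: `t x` is the common point of the cosets `r x + N Pⁿ` with `r ∈ R` congruent to `t`
modulo `πⁿ`. -/
theorem IsAdicExtension.exists_module (hT : IsAdicExtension P π T) {N : Type v} [AddCommGroup N]
    [Module R N] (hc : IsAlgCompact R N)
    (hred : ∀ x : N, (∀ n : ℕ, x ∈ P ^ n • (⊤ : Submodule R N)) → x = 0) :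
    ∃ _ : Module T N, (∀ (r : R) (x : N), algebraMap R T r • x = r • x) ∧
      ∀ (f : N →ₗ[R] N) (t : T) (x : N), t • f x = f (t • x) := by
  classical
  let ρ : T → N → N → Prop := fun t x y => ∀ (n : ℕ) (r : R) (t' : T),
    t = algebraMap R T r + algebraMap R T (π ^ n) * t' →
      y - r • x ∈ P ^ n • (⊤ : Submodule R N)
  -- One representative of `t` modulo `πⁿ` suffices for the condition at `n`.
  have hρ : ∀ {t x y}, (∀ n : ℕ, ∃ (r : R) (t' : T),
      t = algebraMap R T r + algebraMap R T (π ^ n) * t' ∧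
        y - r • x ∈ P ^ n • (⊤ : Submodule R N)) → ρ t x y := by
    intro t x y h n r t' ht
    obtain ⟨r₁, t₁, h₁, hy⟩ := h n
    have hr : r₁ - r ∈ P ^ n := hT.mem_pow n _ (t' - t₁) <| by
      rw [map_sub, mul_sub, sub_eq_sub_iff_add_eq_add, ← h₁, ht, add_comm]
    have : y - r • x = (y - r₁ • x) + (r₁ - r) • x := by rw [sub_smul]; abel
    rw [this]
    exact add_mem hy (Submodule.smul_mem_smul hr trivial)
  have hfst : ∀ {t x y}, ρ t x y → ∀ n : ℕ, ∃ (r : R) (t' : T),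
      t = algebraMap R T r + algebraMap R T (π ^ n) * t' ∧
        y - r • x ∈ P ^ n • (⊤ : Submodule R N) := by
    intro t x y h n
    obtain ⟨r, t', ht⟩ := hT.exists_eq t n
    exact ⟨r, t', ht, h n r t' ht⟩
  have hexists : ∀ t x, ∃ y, ρ t x y := by
    intro t x
    choose r t' ht using hT.exists_eq t
    obtain ⟨y, hy⟩ := hc.exists_forall_sub_mem (J := ULift.{u} ℕ) (fun n => r n.down • x)
      (fun n => P ^ n.down) (fun n => IsNoetherian.noetherian _) (by
        intro F
        let k := F.sup ULift.down
        refine ⟨r k • x, fun n hn => ?_⟩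
        have hnk : n.down ≤ k := Finset.le_sup (f := ULift.down) hn
        rw [← sub_smul]
        refine Submodule.smul_mem_smul ?_ trivial
        refine hT.mem_pow n.down _ (t' n.down - algebraMap R T (π ^ (k - n.down)) * t' k) ?_
        rw [map_sub, mul_sub, sub_eq_sub_iff_add_eq_add, ← mul_assoc, ← map_mul, ← pow_add,
          Nat.add_sub_cancel' hnk, ← ht, add_comm, ← ht])
    exact ⟨y, hρ fun n => ⟨r n, t' n, ht n, hy ⟨n⟩⟩⟩
  obtain ⟨m, hm⟩ := exists_module_of_relation ρ hexists
    (by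
      intro t x y y' h h'
      rw [← sub_eq_zero]
      refine hred _ fun n => ?_
      obtain ⟨r, t', ht, hy⟩ := hfst h n
      have := sub_mem hy (h' n r t' ht)
      rwa [sub_sub_sub_cancel_right] at this)
    (by
      intro t₁ t₂ x y₁ y₂ h₁ h₂
      refine hρ fun n => ?_
      obtain ⟨r₁, t₁', rfl, hy₁⟩ := hfst h₁ n
      obtain ⟨r₂, t₂', rfl, hy₂⟩ := hfst h₂ n
      refine ⟨r₁ + r₂, t₁' + t₂', by rw [map_add]; ring, ?_⟩
      rw [add_smul, add_sub_add_comm]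
      exact add_mem hy₁ hy₂)
    (by
      intro t x x' y y' h h' n r t' ht
      rw [smul_add, add_sub_add_comm]
      exact add_mem (h n r t' ht) (h' n r t' ht))
    (fun x => hρ fun n => ⟨1, 0, by simp, by simp⟩)
    (by
      intro t₁ t₂ x y z h₂ h₁
      refine hρ fun n => ?_
      obtain ⟨r₁, t₁', rfl, hz⟩ := hfst h₁ n
      obtain ⟨r₂, t₂', rfl, hy⟩ := hfst h₂ n
      refine ⟨r₁ * r₂, algebraMap R T r₁ * t₂' + algebraMap R T r₂ * t₁'
        + algebraMap R T (π ^ n) * t₁' * t₂', by rw [map_mul]; ring, ?_⟩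
      have : z - (r₁ * r₂) • x = (z - r₁ • y) + r₁ • (y - r₂ • x) := by
        rw [smul_sub, mul_smul]; abel
      rw [this]
      exact add_mem hz (Submodule.smul_mem _ _ hy))
  refine ⟨m, fun r x => hm _ _ _ (hρ fun n => ⟨r, 0, by simp, by simp⟩), fun f t x => ?_⟩
  have hex : ρ t x (t • x) := by
    obtain ⟨y, hy⟩ := hexists t x
    rwa [hm t x y hy]
  refine hm _ _ _ fun n r t' ht => ?_
  rw [← map_smul, ← map_sub]
  have : Submodule.map f (P ^ n • ⊤) ≤ P ^ n • (⊤ : Submodule R N) := by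
    rw [Submodule.map_smul'']
    exact Submodule.smul_mono le_rfl le_top
  exact this ⟨_, hex n r t' ht, rfl⟩

end Completion

/-- Commuting actions of `T` and of `Λ` (on the right) combine to a right action of `T ⊗ Λ`. -/
theorem exists_module_tensorProduct {R T Λ : Type*} [CommRing R] [CommRing T] [Ring Λ]
    [Algebra R T] [Algebra R Λ] {N : Type*} [AddCommGroup N] [Module R N] [Module T N]
    [Module Λᵐᵒᵖ N] [IsScalarTower R T N] [IsScalarTower R Λᵐᵒᵖ N] [SMulCommClass T Λᵐᵒᵖ N] :
    ∃ _ : Module (T ⊗[R] Λ)ᵐᵒᵖ N, ∀ (l : Λ) (x : N),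
      MulOpposite.op ((1 : T) ⊗ₜ[R] l) • x = MulOpposite.op l • x := by
  let _ : Module Tᵐᵒᵖ N := Module.compHom N (RingEquiv.toOpposite T).symm.toRingHom
  have hT : ∀ (t : Tᵐᵒᵖ) (x : N), t • x = t.unop • x := fun _ _ => rfl
  have : IsScalarTower R Tᵐᵒᵖ N := ⟨fun r t x => by
    rw [hT, hT, MulOpposite.unop_smul, smul_assoc]⟩
  have : SMulCommClass Tᵐᵒᵖ Λᵐᵒᵖ N := ⟨fun t l x => by rw [hT, hT, smul_comm]⟩
  let _ : Module (Tᵐᵒᵖ ⊗[R] Λᵐᵒᵖ) N := TensorProduct.Algebra.module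
  refine ⟨Module.compHom N
    (Algebra.TensorProduct.opAlgEquiv R R T Λ).symm.toRingEquiv.toRingHom, fun l x => ?_⟩
  change (Algebra.TensorProduct.opAlgEquiv R R T Λ).symm (MulOpposite.op ((1 : T) ⊗ₜ[R] l)) • x = _
  rw [Algebra.TensorProduct.opAlgEquiv_symm_tmul, TensorProduct.Algebra.smul_def, hT]
  simp

/-- Over `T ⊗ Λ`, with `T` like the `P`-adic completion of `R`, modules separated for the `P`-adic
topology are rigid: a `Λ`-linear map is `P`-adically continuous, and `T` is `R` up to any power
of `P`. -/
theorem IsAdicExtension.isRigid {R T Λ : Type u} [CommRing R] [CommRing T] [Ring Λ]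
    [Algebra R T] [Algebra R Λ] {P : Ideal R} {π : R} (hT : IsAdicExtension P π T)
    {N : Type v} [AddCommGroup N] [Module (T ⊗[R] Λ)ᵐᵒᵖ N]
    (hred : IsReducedAt (T ⊗[R] Λ)ᵐᵒᵖ P N) :
    IsRigid (RingHom.op
      (Algebra.TensorProduct.includeRight : Λ →ₐ[R] T ⊗[R] Λ).toRingHom) N := by
  intro Y _ _ h hh
  have hR : ∀ (r : R) (y : Y), h (algebraMap R (T ⊗[R] Λ)ᵐᵒᵖ r • y)
      = algebraMap R (T ⊗[R] Λ)ᵐᵒᵖ r • h y := by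
    intro r y
    have := hh (algebraMap R Λᵐᵒᵖ r) y
    have h1 : RingHom.op (Algebra.TensorProduct.includeRight : Λ →ₐ[R] T ⊗[R] Λ).toRingHom
        (algebraMap R Λᵐᵒᵖ r) = algebraMap R (T ⊗[R] Λ)ᵐᵒᵖ r :=
      congrArg MulOpposite.op
        ((Algebra.TensorProduct.includeRight : Λ →ₐ[R] T ⊗[R] Λ).commutes r)
    rwa [h1] at this
  have hTl : ∀ (t : T) (y : Y), h (MulOpposite.op (t ⊗ₜ[R] (1 : Λ)) • y)
      = MulOpposite.op (t ⊗ₜ[R] (1 : Λ)) • h y := by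
    intro t y
    rw [← sub_eq_zero, ← Submodule.mem_bot (T ⊗[R] Λ)ᵐᵒᵖ, ← hred, Submodule.mem_iInf]
    intro n
    obtain ⟨r, t', rfl⟩ := hT.exists_eq t n
    have h2 : MulOpposite.op ((algebraMap R T r + algebraMap R T (π ^ n) * t') ⊗ₜ[R] (1 : Λ))
        = algebraMap R (T ⊗[R] Λ)ᵐᵒᵖ r
          + algebraMap R (T ⊗[R] Λ)ᵐᵒᵖ (π ^ n) * MulOpposite.op (t' ⊗ₜ[R] (1 : Λ)) := by
      rw [MulOpposite.algebraMap_apply, MulOpposite.algebraMap_apply, ← MulOpposite.op_mul,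
        ← MulOpposite.op_add, Algebra.TensorProduct.algebraMap_apply,
        Algebra.TensorProduct.algebraMap_apply, Algebra.TensorProduct.tmul_mul_tmul,
        TensorProduct.add_tmul, mul_one, mul_comm]
    rw [h2, add_smul, add_smul, map_add, hR, mul_smul, mul_smul, hR, add_sub_add_left_eq_sub,
      ← smul_sub]
    exact Submodule.subset_span ⟨π ^ n, Ideal.pow_mem_pow hT.mem n, _, rfl⟩
  rintro ⟨t⟩ y
  change h (MulOpposite.op t • y) = MulOpposite.op t • h y
  induction t using TensorProduct.induction_on generalizing y with
  | zero => simp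
  | add t t' ht ht' => rw [MulOpposite.op_add, add_smul, add_smul, map_add, ht, ht']
  | tmul t l =>
    have h3 : MulOpposite.op (t ⊗ₜ[R] l) = MulOpposite.op ((1 : T) ⊗ₜ[R] l)
        * MulOpposite.op (t ⊗ₜ[R] (1 : Λ)) := by
      rw [← MulOpposite.op_mul, Algebra.TensorProduct.tmul_mul_tmul, mul_one, one_mul]
    rw [h3, mul_smul, mul_smul, ← hTl]
    exact hh (MulOpposite.op l) _

/-! ### Localizations and completions of Dedekind domains and of orders -/

section Localization

variable {R : Type u} {A : Type u} [CommRing R] [Ring A] [Algebra R A]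

theorem exists_dvd_algebraMap_locR (P : HeightOneSpectrum R) {t : LocR P} (ht : t ≠ 0) :
    ∃ r : R, r ≠ 0 ∧ t ∣ algebraMap R (LocR P) r := by
  obtain ⟨⟨r, s⟩, h⟩ := IsLocalization.surj P.asIdeal.primeCompl t
  refine ⟨r, ?_, _, h.symm⟩
  rintro rfl
  rw [map_zero] at h
  exact ht ((IsLocalization.map_units (LocR P) s).mul_left_eq_zero.1 h)

/-- The order `Λ_P`, opposed, is a ring of fractions of `Λ`, opposed. -/
theorem exists_smul_eq_toLocOrder (Λ : Subalgebra R A) (P : HeightOneSpectrum R)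
    (t : (LocOrder Λ P)ᵐᵒᵖ) : ∃ s ∈ P.asIdeal.primeCompl, ∃ l : Λᵐᵒᵖ,
      algebraMap R (LocOrder Λ P)ᵐᵒᵖ s * t = RingHom.op (toLocOrder Λ P) l := by
  have : IsLocalizedModule P.asIdeal.primeCompl (TensorProduct.mk R (LocR P) Λ 1) :=
    (isLocalizedModule_iff_isBaseChange P.asIdeal.primeCompl (LocR P) _).2
      (TensorProduct.isBaseChange R Λ (LocR P))
  obtain ⟨⟨l, s⟩, h⟩ := IsLocalizedModule.surj P.asIdeal.primeCompl
    (TensorProduct.mk R (LocR P) Λ 1) t.unop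
  refine ⟨s, s.2, MulOpposite.op l, ?_⟩
  rw [← Algebra.smul_def]
  exact congrArg MulOpposite.op h

theorem exists_smul_eq_zero_of_toLocOrder (Λ : Subalgebra R A) (P : HeightOneSpectrum R)
    (l : Λᵐᵒᵖ) (hl : RingHom.op (toLocOrder Λ P) l = 0) :
    ∃ s ∈ P.asIdeal.primeCompl, s • l = 0 := by
  have : IsLocalizedModule P.asIdeal.primeCompl (TensorProduct.mk R (LocR P) Λ 1) :=
    (isLocalizedModule_iff_isBaseChange P.asIdeal.primeCompl (LocR P) _).2
      (TensorProduct.isBaseChange R Λ (LocR P))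
  obtain ⟨s, hs⟩ := (IsLocalizedModule.eq_zero_iff P.asIdeal.primeCompl
    (TensorProduct.mk R (LocR P) Λ 1)).1 (congrArg MulOpposite.unop hl)
  exact ⟨s, s.2, congrArg MulOpposite.op hs⟩

theorem isUnit_algebraMap_locOrder (Λ : Subalgebra R A) (P : HeightOneSpectrum R) {s : R}
    (hs : s ∈ P.asIdeal.primeCompl) : IsUnit (algebraMap R (LocOrder Λ P)ᵐᵒᵖ s) := by
  rw [MulOpposite.algebraMap_apply, IsScalarTower.algebraMap_apply R (LocR P) (LocOrder Λ P)]
  exact ((IsLocalization.map_units (LocR P) ⟨s, hs⟩).map _).op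

end Localization

section Completion

variable {R : Type u} {Q : Type u} {A : Type u} [CommRing R] [IsDedekindDomain R] [Field Q]
  [Algebra R Q] [IsFractionRing R Q] [Ring A] [Algebra R A]

theorem valued_algebraMap_complR (P : HeightOneSpectrum R) (r : R) :
    Valued.v ((algebraMap R (ComplR Q P) r : ComplR Q P) : P.adicCompletion Q)
      = P.intValuation r := by
  rw [← HeightOneSpectrum.valuation_of_algebraMap (K := Q)]
  exact HeightOneSpectrum.valuedAdicCompletion_eq_valuation' P (algebraMap R Q r)

theorem dvd_complR {P : HeightOneSpectrum R} {x y : ComplR Q P}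
    (h : Valued.v (x : P.adicCompletion Q) ≤ Valued.v (y : P.adicCompletion Q)) : y ∣ x :=
  (HeightOneSpectrum.adicCompletionIntegers.integers Q P).dvd_of_le h

theorem exists_uniformizer_isAdicExtension (P : HeightOneSpectrum R) :
    ∃ π : R, IsAdicExtension P.asIdeal π (ComplR Q P) := by
  obtain ⟨π, hπ⟩ := P.intValuation_exists_uniformizer
  have hπn : ∀ n : ℕ, P.intValuation (π ^ n) = WithZero.exp (-(n : ℤ)) := fun n => by
    rw [map_pow, hπ, ← WithZero.exp_nsmul]
    simp
  refine ⟨π, ?_, fun t n => ?_, fun n r t h => ?_⟩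
  · rw [← P.intValuation_lt_one_iff_mem, hπ, ← WithZero.exp_zero, WithZero.exp_lt_exp]
    norm_num
  · set c : P.adicCompletion Q := ((algebraMap R (ComplR Q P) (π ^ n) : ComplR Q P) :) with hc
    have hvc : Valued.v c = WithZero.exp (-(n : ℤ)) := by rw [hc, valued_algebraMap_complR, hπn]
    have hc0 : (0 : WithZero (Multiplicative ℤ)) < Valued.v c := by
      rw [hvc]; exact WithZero.exp_pos
    -- Approximate `t` by an element of `Q`, and that one by an element of `R`.
    obtain ⟨q, hq⟩ : ∃ q : Q, Valued.v ((q : P.adicCompletion Q) - t) < Valued.v c := by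
      have hopen : IsOpen {x : P.adicCompletion Q | Valued.v (x - t) < Valued.v c} := by
        have := (Valued.isOpen_ball (P.adicCompletion Q) (Valued.v.restrict c)).preimage
          (continuous_sub_right (t : P.adicCompletion Q))
        convert this using 1
        ext x
        exact (Valuation.restrict_lt_iff (v := (Valued.v : Valuation (P.adicCompletion Q) _))).symm
      exact (HeightOneSpectrum.denseRange_algebraMap Q P).exists_mem_open hopen
        ⟨t, by simpa using hc0⟩
    have hq1 : P.valuation Q q ≤ 1 := by
      rw [← HeightOneSpectrum.valuedAdicCompletion_eq_valuation' P q,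
        ← sub_add_cancel (q : P.adicCompletion Q) t]
      refine (Valuation.map_add _ _ _).trans (max_le (hq.le.trans ?_) t.2)
      exact (algebraMap R (ComplR Q P) (π ^ n)).2
    obtain ⟨a, ha⟩ := P.exists_valuation_sub_lt_of_integer hq1 (Units.mk0 _ hc0.ne')
    have hat : Valued.v ((t - algebraMap R (ComplR Q P) a : ComplR Q P) : P.adicCompletion Q)
        ≤ Valued.v c := by
      have h1 : Valued.v ((algebraMap R Q a - q : Q) : P.adicCompletion Q) < Valued.v c := by
        rw [HeightOneSpectrum.valuedAdicCompletion_eq_valuation']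
        exact ha
      have h2 : ((t - algebraMap R (ComplR Q P) a : ComplR Q P) : P.adicCompletion Q)
          = -(((algebraMap R Q a - q : Q) : P.adicCompletion Q)
            + ((q : P.adicCompletion Q) - t)) := by
        have h3 : ((algebraMap R Q a - q : Q) : P.adicCompletion Q)
            = (algebraMap R Q a : Q) - (q : P.adicCompletion Q) :=
          map_sub (algebraMap Q (P.adicCompletion Q)) _ _
        rw [h3, sub_add_sub_cancel, neg_sub]
        rfl
      rw [h2, Valuation.map_neg]
      exact (Valuation.map_add _ _ _).trans (max_le h1.le hq.le)
    obtain ⟨t', ht'⟩ := dvd_complR hat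
    exact ⟨a, t', by rw [← ht', add_sub_cancel]⟩
  · rw [← P.intValuation_le_pow_iff_mem, ← valued_algebraMap_complR (Q := Q), h]
    have := valued_algebraMap_complR (Q := Q) P (π ^ n)
    rw [hπn] at this
    rw [← this]
    change Valued.v (_ * _) ≤ _
    rw [map_mul]
    exact mul_le_of_le_one_right' t.2

theorem algebraMap_complR_injective (P : HeightOneSpectrum R) :
    Function.Injective (algebraMap R (ComplR Q P)) :=
  FaithfulSMul.algebraMap_injective _ _

theorem exists_dvd_algebraMap_complR (P : HeightOneSpectrum R) {t : ComplR Q P} (ht : t ≠ 0) :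
    ∃ r : R, r ≠ 0 ∧ t ∣ algebraMap R (ComplR Q P) r := by
  obtain ⟨r, hr, h⟩ :=
    HeightOneSpectrum.adicCompletion.mul_nonZeroDivisor_mem_adicCompletionIntegers P
      (t : P.adicCompletion Q)⁻¹
  refine ⟨r, nonZeroDivisors.ne_zero hr, ⟨_, h⟩, Subtype.ext ?_⟩
  have ht' : (t : P.adicCompletion Q) ≠ 0 := fun h => ht (Subtype.ext h)
  exact (mul_inv_cancel_left₀ ht' _).symm

theorem algebraMap_locR_injective (P : HeightOneSpectrum R) :
    Function.Injective (algebraMap R (LocR P)) :=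
  IsLocalization.injective _ P.asIdeal.primeCompl_le_nonZeroDivisors

theorem toComplOrder_eq_comp (Λ : Subalgebra R A) (P : HeightOneSpectrum R) :
    toComplOrder Q Λ P = (locToComplOrder Q Λ P).comp (toLocOrder Λ P) := by
  refine RingHom.ext fun l => ?_
  simp [toComplOrder, locToComplOrder, toLocOrder]

theorem IsOrder.exists_algebraMap_mul_mem [Algebra Q A] [IsScalarTower R Q A] {Λ : Subalgebra R A}
    (hΛ : IsOrder Q Λ) (a : A) : ∃ r : R, r ≠ 0 ∧ algebraMap R A r * a ∈ Λ := by
  have ha : a ∈ Submodule.span Q (Λ : Set A) := hΛ.span_eq_top ▸ Submodule.mem_top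
  induction ha using Submodule.span_induction with
  | mem a ha => exact ⟨1, one_ne_zero, by simpa using ha⟩
  | zero => exact ⟨1, one_ne_zero, by simp⟩
  | add a b _ _ h h' =>
    obtain ⟨r, hr, h⟩ := h
    obtain ⟨r', hr', h'⟩ := h'
    refine ⟨r' * r, mul_ne_zero hr' hr, ?_⟩
    have h1 := Λ.mul_mem (Λ.algebraMap_mem r') h
    have h2 := Λ.mul_mem (Λ.algebraMap_mem r) h'
    rw [mul_add]
    refine add_mem ?_ ?_
    · rwa [map_mul, mul_assoc]
    · rwa [mul_comm, map_mul, mul_assoc]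
  | smul q a _ h =>
    obtain ⟨r, hr, h⟩ := h
    obtain ⟨x, s, hs, rfl⟩ := IsFractionRing.div_surjective (A := R) q
    have hs0 : algebraMap R Q s ≠ 0 := by
      simpa using nonZeroDivisors.ne_zero hs
    refine ⟨s * r, mul_ne_zero (nonZeroDivisors.ne_zero hs) hr, ?_⟩
    have h1 := Λ.mul_mem (Λ.algebraMap_mem x) h
    convert h1 using 1
    rw [← Algebra.smul_def, ← Algebra.smul_def, ← Algebra.smul_def,
      ← IsScalarTower.algebraMap_smul Q (s * r), ← IsScalarTower.algebraMap_smul Q r,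
      ← IsScalarTower.algebraMap_smul Q x, smul_smul, smul_smul, map_mul]
    congr 1
    field_simp

end Completion

/-! ### Points over an order, its localizations and its completions -/

/-- Over a semisimple ring every module is injective, and the indecomposable modules are the simple
ones. -/
theorem SimpleClasses_eq_Zg (A : Type u) [Ring A] [IsSemisimpleRing A] :
    SimpleClasses.{u, w} A = Zg A := by
  ext c
  constructor
  · rintro ⟨N, rfl, hN⟩
    refine cls_mem_Zg_iff.2 ⟨⟨IsSimpleModule.nontrivial Aᵐᵒᵖ N, fun X Y hXY => ?_⟩, ?_⟩
    · rcases eq_bot_or_eq_top X with h | h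
      · exact Or.inl h
      · rw [h] at hXY
        exact Or.inr (by simpa using hXY.disjoint)
    · intro X Y _ _ _ _ f hf g
      refine IsSemisimpleModule.extension_property f ?_ g
      rw [← LinearMap.ker_eq_bot, Submodule.eq_bot_iff]
      intro x hx
      obtain ⟨_, h⟩ := hf 1 0 (fun _ => Fin.elim0) (fun _ => x)
        ⟨Fin.elim0, fun _ => by simpa using (LinearMap.mem_ker.1 hx).symm⟩
      simpa using (h 0).symm
  · rintro ⟨N, rfl, hN, -⟩
    have := hN.1
    refine ⟨N, rfl, (isSimpleModule_iff _ _).2 ⟨fun X => ?_⟩⟩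
    obtain ⟨Y, hXY⟩ := exists_isCompl X
    rcases hN.2 X Y hXY with h | h
    · exact Or.inl h
    · rw [h] at hXY
      exact Or.inr (by simpa using hXY.codisjoint)

section Restriction

variable {T S S' : Type u} [CommRing T] [Ring S] [Ring S'] [Algebra T S] [Algebra T S']
  {φ : S →+* S'} {M : RightMod.{u, w} S'}

theorem res_cls_mem_ZgTf_iff (hφ : ∀ r, φ (algebraMap T S r) = algebraMap T S' r)
    (hM : IsRigid (RingHom.op φ) M) :
    res φ (cls M) ∈ ZgTf T S ↔ cls M ∈ ZgTf T S' := by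
  let e : (ModuleCat.restrictScalars (RingHom.op φ)).obj M ≃+ M := AddEquiv.refl M
  have he : ∀ (s : Sᵐᵒᵖ) (m), e (s • m) = RingHom.op φ s • e m := fun _ _ => rfl
  rw [res_cls, cls_mem_ZgTf_iff, cls_mem_ZgTf_iff, hM.isIndecomposable_iff e he,
    hM.isPureInjective_iff e he,
    isTorsionfreeOver_iff (fun r => congrArg MulOpposite.op (hφ r)) e he]

theorem res_mem_Red_iff (hφ : ∀ r, φ (algebraMap T S r) = algebraMap T S' r) (P : Ideal T)
    (c : RightModClass.{u, w} S') :
    res φ c ∈ Red S P ↔ c ∈ Red S' P := by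
  obtain ⟨M, rfl⟩ := exists_cls_eq c
  rw [res_cls, cls_mem_Red_iff, cls_mem_Red_iff]
  exact isReducedAt_iff (φ := RingHom.op φ)
    (M := (ModuleCat.restrictScalars (RingHom.op φ)).obj M)
    (fun r => congrArg MulOpposite.op (hφ r))
    (AddEquiv.refl M) (fun _ _ => rfl) P

end Restriction

theorem ZgTf_eq_of_dvd {R T S : Type u} [CommRing R] [CommRing T] [Ring S]
    [Algebra R T] [Algebra T S] [Algebra R S] [IsScalarTower R T S]
    (hinj : Function.Injective (algebraMap R T))
    (hdvd : ∀ t : T, t ≠ 0 → ∃ r : R, r ≠ 0 ∧ t ∣ algebraMap R T r) :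
    ZgTf.{u, w} T S = ZgTf R S := by
  have : IsScalarTower R T Sᵐᵒᵖ := .of_algebraMap_eq fun r =>
    congrArg MulOpposite.op (IsScalarTower.algebraMap_apply R T S r)
  ext c
  obtain ⟨N, rfl⟩ := exists_cls_eq c
  rw [cls_mem_ZgTf_iff, cls_mem_ZgTf_iff, isTorsionfreeOver_iff_of_dvd hinj hdvd]

theorem toLocOrder_algebraMap {R A : Type u} [CommRing R] [Ring A] [Algebra R A]
    (Λ : Subalgebra R A) (P : HeightOneSpectrum R) (r : R) :
    toLocOrder Λ P (algebraMap R Λ r) = algebraMap R (LocOrder Λ P) r :=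
  (Algebra.TensorProduct.includeRight : Λ →ₐ[R] LocR P ⊗[R] Λ).commutes r

theorem isRigid_locOrder {R A : Type u} [CommRing R] [Ring A] [Algebra R A]
    (Λ : Subalgebra R A) (P : HeightOneSpectrum R) (M : RightMod.{u, w} (LocOrder Λ P)) :
    IsRigid (RingHom.op (toLocOrder Λ P)) M :=
  isRigid_of_fractions _ (fun r => congrArg MulOpposite.op (toLocOrder_algebraMap Λ P r))
    P.asIdeal.primeCompl (exists_smul_eq_toLocOrder Λ P)
    fun _ hs => isUnit_algebraMap_locOrder Λ P hs

theorem res_toLocOrder_injective {R A : Type u} [CommRing R] [Ring A] [Algebra R A]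
    (Λ : Subalgebra R A) (P : HeightOneSpectrum R) :
    Function.Injective (res.{u, w} (toLocOrder Λ P)) := by
  intro c c' h
  obtain ⟨M, rfl⟩ := exists_cls_eq c
  obtain ⟨M', rfl⟩ := exists_cls_eq c'
  exact cls_eq_of_res_eq (isRigid_locOrder Λ P M) h

section

variable {R Q A : Type u} [CommRing R] [IsDedekindDomain R] [Field Q] [Algebra R Q]
  [IsFractionRing R Q] [Ring A] [Algebra R A] (Λ : Subalgebra R A) (P : HeightOneSpectrum R)

variable (Q) in
theorem toComplOrder_algebraMap (r : R) :
    toComplOrder Q Λ P (algebraMap R Λ r) = algebraMap R (ComplOrder Q Λ P) r :=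
  (Algebra.TensorProduct.includeRight : Λ →ₐ[R] ComplR Q P ⊗[R] Λ).commutes r

theorem isRigid_complOrder {M : RightMod.{u, w} (ComplOrder Q Λ P)}
    (hM : IsReducedAt (ComplOrder Q Λ P)ᵐᵒᵖ P.asIdeal M) :
    IsRigid (RingHom.op (toComplOrder Q Λ P)) M := by
  obtain ⟨π, hπ⟩ := exists_uniformizer_isAdicExtension (Q := Q) P
  exact hπ.isRigid hM

/-- Over `Λ_P`, the reduced torsionfree points are those whose restriction to `Λ` is a torsionfree
point reduced at `P`. -/
theorem mem_ZgTfRedLoc_iff (c : RightModClass.{u, w} (LocOrder Λ P)) :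
    c ∈ ZgTfRedLoc Λ P ↔ res (toLocOrder Λ P) c ∈ ZgTf R Λ ∩ Red Λ P.asIdeal := by
  unfold ZgTfRedLoc
  rw [ZgTf_eq_of_dvd (algebraMap_locR_injective P) fun t ht => exists_dvd_algebraMap_locR P ht]
  refine and_congr ?_ (res_mem_Red_iff (toLocOrder_algebraMap Λ P) _ c).symm
  obtain ⟨M, rfl⟩ := exists_cls_eq c
  exact (res_cls_mem_ZgTf_iff (toLocOrder_algebraMap Λ P) (isRigid_locOrder Λ P M)).symm

/-- Over `Λ̂_P`, the reduced torsionfree points are those whose restriction to `Λ` is a torsionfree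
point reduced at `P`. -/
theorem mem_ZgTfRedCompl_iff (c : RightModClass.{u, w} (ComplOrder Q Λ P)) :
    c ∈ ZgTfRedCompl Q Λ P ↔ res (toComplOrder Q Λ P) c ∈ ZgTf R Λ ∩ Red Λ P.asIdeal := by
  unfold ZgTfRedCompl
  rw [ZgTf_eq_of_dvd (algebraMap_complR_injective P) fun t ht => exists_dvd_algebraMap_complR P ht,
    Set.mem_inter_iff, Set.mem_inter_iff, res_mem_Red_iff (toComplOrder_algebraMap Q Λ P)]
  refine and_congr_left fun hc => ?_
  obtain ⟨M, rfl⟩ := exists_cls_eq c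
  exact (res_cls_mem_ZgTf_iff (toComplOrder_algebraMap Q Λ P)
    (isRigid_complOrder Λ P (cls_mem_Red_iff.1 hc))).symm

variable (Q) in
theorem injOn_res_toComplOrder :
    Set.InjOn (res.{u, w} (toComplOrder Q Λ P)) (ZgTfRedCompl Q Λ P) := by
  intro c hc c' _ h
  obtain ⟨M, rfl⟩ := exists_cls_eq c
  obtain ⟨M', rfl⟩ := exists_cls_eq c'
  exact cls_eq_of_res_eq (isRigid_complOrder Λ P (cls_mem_Red_iff.1 hc.2)) h

variable {Λ P}

/-- A torsionfree point over `Λ` that is reduced at `P` is a `Λ_P`-module: the elements outside `P`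
act injectively by torsionfreeness, and surjectively by algebraic compactness. -/
theorem exists_res_toLocOrder_eq {c : RightModClass.{u, w} Λ}
    (hc : c ∈ ZgTf R Λ ∩ Red Λ P.asIdeal) :
    ∃ c', res (toLocOrder Λ P) c' = c := by
  obtain ⟨N, rfl⟩ := exists_cls_eq c
  obtain ⟨-, hpi, htf⟩ := cls_mem_ZgTf_iff.1 hc.1
  have hred := cls_mem_Red_iff.1 hc.2
  obtain ⟨_, _⟩ := exists_compatible_module R Λᵐᵒᵖ N
  rw [isTorsionfreeOver_iff_smul] at htf
  let φ : Λᵐᵒᵖ →ₐ[R] (LocOrder Λ P)ᵐᵒᵖ :=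
    AlgHom.op (Algebra.TensorProduct.includeRight : Λ →ₐ[R] LocR P ⊗[R] Λ)
  obtain ⟨m, hm⟩ := exists_module_of_fractions (N := N) φ P.asIdeal.primeCompl
    (exists_smul_eq_toLocOrder Λ P) (exists_smul_eq_zero_of_toLocOrder Λ P)
    (fun s hs => htf s fun h => hs (h ▸ zero_mem _))
    (fun s hs => hpi.isAlgCompact_of_algebra.exists_smul_eq_of_isReducedAt hred hs)
  obtain ⟨M, hM⟩ := exists_res_eq (φ := toLocOrder Λ P) m fun l x => hm (MulOpposite.op l) x
  exact ⟨_, hM⟩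

variable (Q) in
/-- A pure-injective module over `Λ` that is reduced at `P` is `P`-adically complete, hence a
`Λ̂_P`-module. -/
theorem exists_res_toComplOrder_eq {c : RightModClass.{u, w} Λ}
    (hc : c ∈ ZgTf R Λ ∩ Red Λ P.asIdeal) :
    ∃ c', res (toComplOrder Q Λ P) c' = c := by
  obtain ⟨N, rfl⟩ := exists_cls_eq c
  obtain ⟨-, hpi, -⟩ := cls_mem_ZgTf_iff.1 hc.1
  have hred := cls_mem_Red_iff.1 hc.2
  obtain ⟨_, _⟩ := exists_compatible_module R Λᵐᵒᵖ N
  obtain ⟨π, hπ⟩ := exists_uniformizer_isAdicExtension (Q := Q) P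
  obtain ⟨_, hR, hcomm⟩ := hπ.exists_module hpi.isAlgCompact_of_algebra fun x hx => by
    have : x ∈ infPow Λᵐᵒᵖ N P.asIdeal := hx
    rwa [isReducedAt_iff_infPow.1 hred, Submodule.mem_bot] at this
  have : IsScalarTower R (ComplR Q P) N := ⟨fun r t x => by
    rw [Algebra.smul_def, mul_smul, hR]⟩
  have : SMulCommClass (ComplR Q P) Λᵐᵒᵖ N := ⟨fun t l x =>
    hcomm (Module.toModuleEnd R (S := Λᵐᵒᵖ) N l) t x⟩
  obtain ⟨m, hm⟩ := exists_module_tensorProduct (R := R) (T := ComplR Q P) (Λ := Λ) (N := N)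
  obtain ⟨M, hM⟩ := exists_res_eq (φ := toComplOrder Q Λ P) m hm
  exact ⟨_, hM⟩

theorem image_res_toComplOrder :
    res.{u, w} (toComplOrder Q Λ P) '' ZgTfRedCompl Q Λ P = ZgTf R Λ ∩ Red Λ P.asIdeal := by
  ext c
  constructor
  · rintro ⟨c, hc, rfl⟩
    exact (mem_ZgTfRedCompl_iff Λ P c).1 hc
  · intro hc
    obtain ⟨c, rfl⟩ := exists_res_toComplOrder_eq Q hc
    exact ⟨c, (mem_ZgTfRedCompl_iff Λ P c).2 hc, rfl⟩

theorem image_res_toLocOrder :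
    res.{u, w} (toLocOrder Λ P) '' ZgTfRedLoc Λ P = ZgTf R Λ ∩ Red Λ P.asIdeal := by
  ext c
  constructor
  · rintro ⟨c, hc, rfl⟩
    exact (mem_ZgTfRedLoc_iff Λ P c).1 hc
  · intro hc
    obtain ⟨c, rfl⟩ := exists_res_toLocOrder_eq hc
    exact ⟨c, (mem_ZgTfRedLoc_iff Λ P c).2 hc, rfl⟩

/-- No point is reduced at two maximal ideals: elements of the second outside the first would act
surjectively. -/
theorem disjoint_Red {P' : HeightOneSpectrum R} (hP : P ≠ P') :
    Disjoint (ZgTf.{u, w} R Λ ∩ Red Λ P.asIdeal) (ZgTf R Λ ∩ Red Λ P'.asIdeal) := by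
  rw [Set.disjoint_left]
  intro c hc hc'
  obtain ⟨N, rfl⟩ := exists_cls_eq c
  obtain ⟨hind, hpi, -⟩ := cls_mem_ZgTf_iff.1 hc.1
  obtain ⟨_, _⟩ := exists_compatible_module R Λᵐᵒᵖ N
  obtain ⟨s, hs', hs⟩ : ∃ s ∈ P'.asIdeal, s ∉ P.asIdeal := by
    rw [← SetLike.not_le_iff_exists]
    intro h
    exact hP (HeightOneSpectrum.ext (P'.isMaximal.eq_of_le P.isPrime.ne_top h).symm)
  have := (cls_mem_Red_iff.1 hc'.2).subsingleton hs'
    (hpi.isAlgCompact_of_algebra.exists_smul_eq_of_isReducedAt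
      (cls_mem_Red_iff.1 hc.2) hs)
  exact not_nontrivial N hind.1

end

theorem isUnit_algebraMap_op {R A : Type*} [CommRing R] [Ring A] [Algebra R A] (Q : Type*)
    [Field Q] [Algebra R Q] [IsFractionRing R Q] [Algebra Q A] [IsScalarTower R Q A] {r : R}
    (hr : r ≠ 0) : IsUnit (algebraMap R Aᵐᵒᵖ r) := by
  rw [MulOpposite.algebraMap_apply, IsScalarTower.algebraMap_apply R Q A]
  exact ((IsUnit.mk0 (algebraMap R Q r) (by simpa using hr)).map _).op

theorem disjoint_image_res_Red {R A : Type u} [CommRing R] [Ring A] [Algebra R A] (Q : Type u)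
    [Field Q] [Algebra R Q] [IsFractionRing R Q] [Algebra Q A] [IsScalarTower R Q A]
    {Λ : Subalgebra R A} (P : HeightOneSpectrum R) :
    Disjoint (res.{u, w} Λ.val.toRingHom '' Zg A) (ZgTf R Λ ∩ Red Λ P.asIdeal) := by
  rw [Set.disjoint_left]
  rintro _ ⟨c, hc, rfl⟩ ⟨-, hred⟩
  obtain ⟨M, rfl⟩ := exists_cls_eq c
  have hred := cls_mem_Red_iff.1
    ((res_mem_Red_iff (φ := Λ.val.toRingHom) (fun _ => rfl) P.asIdeal _).1 hred)
  obtain ⟨_, _⟩ := exists_compatible_module R Aᵐᵒᵖ M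
  obtain ⟨s, hs, hs0⟩ := Submodule.exists_mem_ne_zero_of_ne_bot P.ne_bot
  have := hred.subsingleton hs fun x => by
    obtain ⟨u, hu⟩ := isUnit_algebraMap_op Q (A := A) hs0
    refine ⟨(↑u⁻¹ : Aᵐᵒᵖ) • x, ?_⟩
    rw [← algebraMap_smul Aᵐᵒᵖ s, ← hu, smul_smul, Units.mul_inv, one_smul]
  exact not_nontrivial M (cls_mem_Zg_iff.1 hc).1.1

section Semisimple

variable {R Q A : Type u} [CommRing R] [IsDedekindDomain R] [Field Q] [Algebra R Q]
  [IsFractionRing R Q] [Ring A] [Algebra Q A] [Algebra R A] [IsScalarTower R Q A]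
  {Λ : Subalgebra R A}

theorem IsOrder.exists_op_fraction (hΛ : IsOrder Q Λ) (a : Aᵐᵒᵖ) :
    ∃ r : R, r ≠ 0 ∧ ∃ l : Λᵐᵒᵖ, algebraMap R Aᵐᵒᵖ r * a = AlgHom.op Λ.val l := by
  obtain ⟨r, hr, h⟩ := hΛ.exists_algebraMap_mul_mem a.unop
  refine ⟨r, hr, MulOpposite.op ⟨_, h⟩, ?_⟩
  rw [MulOpposite.algebraMap_apply]
  exact congrArg MulOpposite.op (Algebra.commutes r a.unop).symm

theorem IsOrder.isRigid (hΛ : IsOrder Q Λ) (M : RightMod.{u, w} A) :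
    IsRigid (RingHom.op Λ.val.toRingHom) M :=
  isRigid_of_fractions (R := R) _ (fun _ => rfl) (nonZeroDivisors R)
    (fun a => by
      obtain ⟨r, hr, h⟩ := hΛ.exists_op_fraction a
      exact ⟨r, mem_nonZeroDivisors_of_ne_zero hr, h⟩)
    fun _ hr => isUnit_algebraMap_op Q (nonZeroDivisors.ne_zero hr)

theorem IsOrder.res_injective (hΛ : IsOrder Q Λ) :
    Function.Injective (res.{u, w} Λ.val.toRingHom) := by
  intro c c' h
  obtain ⟨M, rfl⟩ := exists_cls_eq c
  obtain ⟨M', rfl⟩ := exists_cls_eq c'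
  exact cls_eq_of_res_eq (hΛ.isRigid M) h

/-- Every point over `A` is torsionfree over `R`, so it is a torsionfree point over `Λ`. -/
theorem IsOrder.res_mem_ZgTf_iff (hΛ : IsOrder Q Λ) (c : RightModClass.{u, w} A) :
    res Λ.val.toRingHom c ∈ ZgTf R Λ ↔ c ∈ Zg A := by
  obtain ⟨M, rfl⟩ := exists_cls_eq c
  rw [res_cls_mem_ZgTf_iff (T := R) (φ := Λ.val.toRingHom) (fun _ => rfl) (hΛ.isRigid M),
    cls_mem_ZgTf_iff, cls_mem_Zg_iff, and_congr_right_iff, and_iff_left_iff_imp]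
  intro _ _ r hr x hx
  exact (isUnit_algebraMap_op Q hr).smul_eq_zero.1 hx

/-- Torsionfree points over `Λ` are restricted from `A` or reduced at some `P`. -/
theorem IsOrder.mem_Red_or_mem_image (hΛ : IsOrder Q Λ) [IsSemisimpleRing A]
    {c : RightModClass.{u, w} Λ} (hc : c ∈ ZgTf R Λ) :
    (∃ P : HeightOneSpectrum R, c ∈ Red Λ P.asIdeal) ∨ c ∈ res Λ.val.toRingHom '' Zg A := by
  obtain ⟨N, rfl⟩ := exists_cls_eq c
  obtain ⟨hind, hpi, htf⟩ := cls_mem_ZgTf_iff.1 hc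
  obtain ⟨_, _⟩ := exists_compatible_module R Λᵐᵒᵖ N
  rw [isTorsionfreeOver_iff_smul] at htf
  have hinj : Function.Injective (AlgHom.op Λ.val) := fun l l' h =>
    MulOpposite.unop_injective (Subtype.ext (congrArg MulOpposite.unop h))
  rcases hind.reduced_or_divisible (AlgHom.op Λ.val) hinj hΛ.exists_op_fraction
    hpi.isAlgCompact_of_algebra htf with ⟨P, hP⟩ | hdiv
  · exact Or.inl ⟨P, cls_mem_Red_iff.2 hP⟩
  · right
    obtain ⟨m, hm⟩ := exists_module_of_fractions (N := N) (AlgHom.op Λ.val) (nonZeroDivisors R)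
      (fun a => by
        obtain ⟨r, hr, h⟩ := hΛ.exists_op_fraction a
        exact ⟨r, mem_nonZeroDivisors_of_ne_zero hr, h⟩)
      (fun l hl => ⟨1, one_mem _, by rw [one_smul]; exact hinj (hl.trans (map_zero _).symm)⟩)
      (fun s hs => htf s (nonZeroDivisors.ne_zero hs))
      (fun s hs => hdiv s (nonZeroDivisors.ne_zero hs))
    obtain ⟨M, hM⟩ := exists_res_eq (φ := Λ.val.toRingHom) m fun l x => hm (MulOpposite.op l) x
    rw [← hM] at hc ⊢
    exact ⟨_, (hΛ.res_mem_ZgTf_iff _).1 hc, rfl⟩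

end Semisimple

end OrderZiegler

/-! ### The decomposition of the torsionfree part -/

theorem theorem3p1 {R Q A : Type u} [CommRing R] [IsDedekindDomain R] [Field Q]
    [Algebra R Q] [IsFractionRing R Q] [Ring A] [Algebra Q A] [Module.Finite Q A]
    [IsSemisimpleRing A] [Algebra R A] [IsScalarTower R Q A]
    (Λ : Subalgebra R A) (hΛ : IsOrder Q Λ) :
    -- every torsionfree point is a simple `A`-module or a reduced point over some `Λ_P`
    (∀ N ∈ ZgTf.{u, w} R Λ,
      N ∈ res Λ.val.toRingHom '' SimpleClasses A ∨
        ∃ P : HeightOneSpectrum R, N ∈ res (toLocOrder Λ P) '' ZgTfRedLoc Λ P) ∧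
    -- a reduced torsionfree point over `Λ_P` is a torsionfree point over `Λ`, and is determined
    -- by its restriction to `Λ`
    (∀ P : HeightOneSpectrum R,
      Set.MapsTo (res (toLocOrder Λ P)) (ZgTfRedLoc.{u, w} Λ P) (ZgTf R Λ) ∧
        Set.InjOn (res (toLocOrder Λ P)) (ZgTfRedLoc.{u, w} Λ P)) ∧
    -- the reduced torsionfree points are the same over `Λ_P` and over `Λ̂_P`
    (∀ P : HeightOneSpectrum R,
      res (locToComplOrder Q Λ P) ⁻¹' ZgTfRedLoc.{u, w} Λ P = ZgTfRedCompl Q Λ P ∧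
        Set.BijOn (res (locToComplOrder Q Λ P)) (ZgTfRedCompl Q Λ P)
          (ZgTfRedLoc.{u, w} Λ P)) ∧
    -- the torsionfree part is the disjoint union of the points over `A` and the reduced
    -- torsionfree points over the completions
    (Set.InjOn (res Λ.val.toRingHom) (Zg.{u, w} A) ∧
      (∀ P : HeightOneSpectrum R,
        Set.InjOn (res (toComplOrder Q Λ P)) (ZgTfRedCompl.{u, w} Q Λ P)) ∧
      ZgTf.{u, w} R Λ = res Λ.val.toRingHom '' Zg A ∪
        ⋃ P : HeightOneSpectrum R, res (toComplOrder Q Λ P) '' ZgTfRedCompl Q Λ P ∧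
      (∀ P : HeightOneSpectrum R, Disjoint (res Λ.val.toRingHom '' Zg.{u, w} A)
        (res (toComplOrder Q Λ P) '' ZgTfRedCompl Q Λ P)) ∧
      Pairwise (Function.onFun Disjoint fun P : HeightOneSpectrum R =>
        res (toComplOrder Q Λ P) '' ZgTfRedCompl.{u, w} Q Λ P)) := by
  have hloc := fun P => image_res_toLocOrder.{u, w} (Λ := Λ) (P := P)
  have hcompl := fun P => image_res_toComplOrder.{u, w} (Q := Q) (Λ := Λ) (P := P)
  have hres : ∀ P, res.{u, w} (toComplOrder Q Λ P)
      = res (toLocOrder Λ P) ∘ res (locToComplOrder Q Λ P) := fun P => by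
    ext c
    rw [Function.comp_apply, res_res, toComplOrder_eq_comp]
  have hpre : ∀ P, res (locToComplOrder Q Λ P) ⁻¹' ZgTfRedLoc.{u, w} Λ P
      = ZgTfRedCompl Q Λ P := fun P => by
    ext c
    rw [Set.mem_preimage, mem_ZgTfRedLoc_iff, mem_ZgTfRedCompl_iff, hres, Function.comp_apply]
  refine ⟨fun N hN => ?_, fun P => ⟨fun c hc => ((mem_ZgTfRedLoc_iff Λ P c).1 hc).1,
    (res_toLocOrder_injective Λ P).injOn⟩, fun P => ⟨hpre P, fun c hc => ?_,
    fun c hc c' hc' h => ?_, fun d hd => ?_⟩, hΛ.res_injective.injOn,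
    fun P => injOn_res_toComplOrder Q Λ P, ?_, fun P => ?_, fun P P' hP => ?_⟩
  · rw [SimpleClasses_eq_Zg]
    rcases hΛ.mem_Red_or_mem_image hN with ⟨P, hP⟩ | h
    · exact Or.inr ⟨P, hloc P ▸ ⟨hN, hP⟩⟩
    · exact Or.inl h
  · exact (hpre P).ge hc
  · exact injOn_res_toComplOrder Q Λ P hc hc' (by rw [hres, Function.comp_apply, h,
      Function.comp_apply])
  · obtain ⟨c, hc⟩ := exists_res_toComplOrder_eq Q ((mem_ZgTfRedLoc_iff Λ P d).1 hd)
    have hcd : res (locToComplOrder Q Λ P) c = d := by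
      rw [hres] at hc
      exact res_toLocOrder_injective Λ P hc
    exact ⟨c, (hpre P).le (hcd ▸ hd : res (locToComplOrder Q Λ P) c ∈ ZgTfRedLoc Λ P), hcd⟩
  · refine Set.Subset.antisymm (fun c hc => ?_)
      (Set.union_subset ?_ (Set.iUnion_subset fun P => ?_))
    · rcases hΛ.mem_Red_or_mem_image hc with ⟨P, hP⟩ | h
      · exact Or.inr (Set.mem_iUnion.2 ⟨P, hcompl P ▸ ⟨hc, hP⟩⟩)
      · exact Or.inl h
    · rintro _ ⟨c, hc, rfl⟩
      exact (hΛ.res_mem_ZgTf_iff c).2 hc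
    · rw [hcompl]
      exact Set.inter_subset_left
  · rw [hcompl]
    exact disjoint_image_res_Red Q P
  · rw [Function.onFun_apply, hcompl, hcompl]
    exact disjoint_Red hP
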